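/- **Data.** Let $k\ge 1$ be an integer and $b\in\mathbb C$ with $|b|=1$, $\mathrm{Re}\,b>0$, $\mathrm{Im}\,b\ne0$; put $Q=b+b^{-1}$, $q=e^{\frac{2\pi i}{k}(1+b^2)}$, $\tilde q=e^{\frac{2\pi i}{k}(1+b^{-2})}$. For $\mu\in\mathbb C$, $m\in\mathbb Z/k\mathbb Z$ let $z=e^{\frac{2\pi i}{k}(-ib\mu-m)}$, $\tilde z=e^{\frac{2\pi i}{k}(-ib^{-1}\mu+m)}$ and $$\Psi_\Delta(\mu|m)=\prod_{j\ge0}\frac{1-q^{j+1}z^{-1}}{1-\tilde q^{-j}\tilde z^{-1}}\ (|q|<1),\qquad \Psi_\Delta(\mu|m)=\prod_{j\ge0}\frac{1-\tilde q^{j+1}\tilde z^{-1}}{1-q^{-j}z^{-1}}\ (|q|>1).$$ For $\vec\mu\in\mathbb C^3$, $\vec m\in(\mathbb Z/k\mathbb Z)^3$ with components indexed by $X,Y,Z$ let $Z_{\rm oct}(\vec\mu|\vec m)=\prod_{i}\Psi_\Delta(\mu_i|m_i)\cdot\Psi_\Delta(iQ-\sum_i\mu_i\,|\,-\sum_i m_i)$.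 Let $\mathfrak P({\rm oct})$ be the set of $(\vec\alpha,\vec\beta)\in\mathbb R^3\times\mathbb R^3$ with, for all $i$ and all $j\ne i$ in $\{X,Y,Z\}$, $$\alpha_i>0,\quad \textstyle\sum_l\alpha_l<Q,\quad \alpha_i+\beta_i<\tfrac Q2,\quad \sum_l\alpha_l+\beta_i>\tfrac Q2,\quad \alpha_j+\beta_j-\beta_i<\tfrac Q2 .$$ Let $\mathbf A,\mathbf B\in\mathrm{Mat}_{15}(\mathbb Z)$, $\vec t\in\mathbb Z^{15}$ be such that $\vec{\mathscr Q}=\mathbf A\vec\Phi+\mathbf B\vec\Pi+i\pi\vec t$, with $\vec\Phi=(X_a,Y_a,Z_a)_{a=1}^5$, $\vec\Pi=(P_{X_a},P_{Y_a},P_{Z_a})_{a=1}^5$, is the following list $\vec{\mathscr Q}$ of 15 affine forms, indexed by the ten pairs $a<b$ and by $a=1,\dots,5$: $2L_{12}=X_3+Y_3+X_4+Y_4+X_5+Y_5+P_{Y_3}+P_{Y_4}+P_{Y_5}-3i\pi$; $2L_{13}=X_2+Y_2+X_5+Y_5+2Z_5+P_{Y_2}+P_{Y_4}-P_{Z_4}+P_{Z_5}-3i\pi$;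 $2L_{14}=X_3+Y_3+2Z_3+P_{Y_2}-P_{Z_2}+P_{Z_3}+P_{Y_5}-P_{Z_5}-2i\pi$; $2L_{15}=X_2+Y_2+2Z_2+X_4+Y_4+2Z_4+P_{Z_2}+P_{Y_3}-P_{Z_3}+P_{Z_4}-4i\pi$; $2L_{23}=X_4-Y_4-P_{X_1}+P_{X_4}-P_{Y_4}-P_{X_5}$; $2L_{24}=-X_1-Y_1+X_5-Y_5-P_{Y_1}-P_{X_3}+P_{X_5}-P_{Y_5}+i\pi$; $2L_{25}=X_1-Y_1+X_3-Y_3+P_{X_1}-P_{Y_1}+P_{X_3}-P_{Y_3}-P_{X_4}$; $2L_{34}=-X_1-Y_1-2Z_1+X_2-Y_2+X_5+Y_5-P_{Z_1}+P_{X_2}-P_{Y_2}+P_{X_5}-P_{Z_5}+i\pi$; $2L_{35}=X_1+Y_1-X_4-Y_4+P_{X_1}-P_{Z_1}-P_{X_2}-P_{X_4}+P_{Z_4}$; $2L_{45}=-X_2-Y_2+X_3+Y_3+P_{Y_1}-P_{Z_1}-P_{X_2}+P_{Z_2}+P_{X_3}-P_{Z_3}$; $\mathcal X_1=-Z_2+Z_5+P_{Y_2}-P_{Z_2}+i\pi$;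 $\mathcal X_2=-X_1+X_5-P_{X_1}+i\pi$; $\mathcal X_3=-X_1-Y_1-Z_1+X_5+Y_5+Z_5+P_{X_5}+i\pi$; $\mathcal X_4=X_1+Y_1+Z_1-X_5+P_{Z_1}-P_{X_5}+P_{Y_5}$; $\mathcal X_5=-X_1+X_4+Y_4+Z_4-P_{X_1}+P_{Y_1}+P_{X_4}$. A *positive angle structure* is a pair $(\vec\alpha,\vec\beta)=(\mathbf A\vec\alpha_0+\mathbf B\vec\beta_0+\frac Q2\vec t,\,-(\mathbf B^T)^{-1}\vec\alpha_0)$ with $(\vec\alpha_0,\vec\beta_0)\in\mathfrak P({\rm oct})^{\times5}$; fix one. Let $Z_\times$ be the product of the five functions $Z_{\rm oct}$ and $$Z_1(\vec\mu|\vec m)=4i\,Z_\times(-\mathbf B^T\vec\mu|-\mathbf B^T\vec m),\qquad Z_2(\vec\mu|\vec m)=(-1)^{\vec m\cdot\mathbf{AB}^T\vec m}e^{\frac{i\pi}k(-\vec\mu\cdot\mathbf{AB}^T\vec\mu+\vec m\cdot\mathbf{AB}^T\vec m)}Z_1(\vec\mu|\vec m),$$ $$\mathcal Z(\vec\mu|\vec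 m)=\frac1{k^{15}}\sum_{\vec n\in(\mathbb Z/k)^{15}}\int_{\mathrm{Im}\,\vec\nu=\vec\beta}d^{15}\nu\; e^{\frac{2\pi i}k(-(\vec\mu-\frac{iQ}2\vec t)\cdot\vec\nu+\vec m\cdot\vec n)}Z_2(\vec\nu|\vec n),\qquad \mathrm{Im}\,\vec\mu=\vec\alpha.$$ **Vertex amplitude.** For $z\in\mathbb C$, $\mu,x,y\in\mathbb R$, $m\in\mathbb Z/k$ let $$\psi_{a,z}(\mu)=e^{-\sqrt2\beta_a\mathrm{Re}z}(\tfrac2k)^{1/4}e^{-\frac\pi k(\mu-\frac k{\pi\sqrt2}\mathrm{Re}z)^2}e^{i\sqrt2\mu\,\mathrm{Im}z},$$ $$\xi_{(x,y)}(m)=(\tfrac2k)^{1/4}e^{-\frac{ikxy}{4\pi}}\sum_{n\in\mathbb Z}e^{-\frac k{4\pi}(\frac{2\pi m}k-2\pi n-x)^2-\frac{ik}{2\pi}y(\frac{2\pi m}k-2\pi n-x)} .$$ Given spins $j_{ab}\in\frac12\mathbb Z_{\ge0}$ and labels $\rho_a=(z_a,x_a,y_a)$ $(a=1,\dots,5)$,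 put $$A_v(\vec j,\vec\rho)=\sum_{\{m_a\}\in(\mathbb Z/k)^5}\int_{\mathbb R^5}\prod_a d\mu_a\;\mathcal Z\big((0,\mu_a)+i\vec\alpha\,\big|\,(m_{ab},m_a)\big)\prod_a\psi_{a,z_a}(\mu_a)\,\xi_{(x_a,y_a)}(m_a),$$ where $-(m_{ab}+t_{ab}k/2)\equiv2j_{ab}+\epsilon_{ab}/2$ mod $k$, with $\epsilon_{ab}=1$ if $k$ and $t_{ab}$ are both odd and $\epsilon_{ab}=0$ otherwise. **Flat connections.** For $j_1,\dots,j_4$ let $\widetilde{\mathcal M}_{\vec j}$ be the space, modulo simultaneous conjugation, of $H_1,\dots,H_4\in SU(2)$ with $H_4H_3H_2H_1=1$ and $\mathrm{Tr}\,H_i=2\cos a_i$, $a_i=2\pi j_i/k$. On it use the coordinates $(\theta,\phi)$ of the geodesic 4-gon $v_1=1$, $v_2=H_1$, $v_3=H_2H_1$, $v_4=H_3H_2H_1$ in $S^3=SU(2)$: $\theta$ is the length of the diagonal $v_1v_3$, with $\max(|a_1-a_2|,|a_3-a_4|)\le\theta\le\min(a_1+a_2,2\pi-a_1-a_2,a_3+a_4,2\pi-a_3-a_4)$,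 and $\phi\in[-\pi,\pi]$ is the oriented bending angle along it; integrals over the moduli space are with respect to $d\theta\,d\phi$. A flat connection on the $a$-th four-holed sphere, whose hole $i\in\{1,2,3,4\}$ leads to the sphere $h_a(i)$, with $h_1=(3,5,4,2)$, $h_2=(4,5,3,1)$, $h_3=(4,1,2,5)$, $h_4=(2,1,3,5)$, $h_5=(3,1,2,4)$, has a label $\rho^{(a)}_{\vec j,\vec\xi}=(z,x,y)$ as follows. Let $\xi_i$ be an eigenvector of $H_i$ for $e^{2\pi ij_i/k}$ and $\xi_i'=\xi_i$ if $a<h_a(i)$, $\xi'_i=(-\bar\xi_i^2,\bar\xi_i^1)^T$ otherwise; let $M(\xi)=\begin{pmatrix}\xi^1&-\bar\xi^2\\ \xi^2&\bar\xi^1\end{pmatrix}$ and $O_4=M(\xi'_4)\,\mathrm{diag}(e^{L},e^{-L})\,M(\xi'_4)^{-1}$ with $L=\frac{\pi i}k(b\,\alpha_{ac}+2j_4+\frac{\epsilon_{ac}}2)$, $c=h_a(4)$ (with $\alpha_{ac}=\alpha_{ca}$, $\epsilon_{ac}=\epsilon_{ca}$). For vectors $r_1,d_1,r_2,d_2\in\mathbb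 C^2$ let $\chi(r_1,d_1,r_2,d_2)=\frac{\langle r_1\wedge d_1\rangle\langle d_2\wedge r_2\rangle}{\langle r_1\wedge d_2\rangle\langle d_1\wedge r_2\rangle}$. Put $e^{\mathcal X}=\chi(\xi'_1,\xi'_2,\xi'_3,\xi'_4)$; $e^{\mathcal Y}=\chi(O_4\xi'_3,\xi'_1,\xi'_2,\xi'_4)$ if $a\ne4$, and $e^{\mathcal Y}=\chi(\xi'_2,\xi'_3,O_4^{-1}\xi'_1,\xi'_4)^{-1}$ if $a=4$. Define real $\mu,m,\nu,n$ by $\mathcal X-i\pi t_a=\frac{2\pi i}k(-ib\mu-m)$, $\mathcal Y=\frac{2\pi i}k(-ib\nu-n)$; then $z=\frac{1}{\sqrt2}\frac{2\pi}k(\mu+i\nu)$ and $x,y\in[0,2\pi)$ are $\frac{2\pi}km,\frac{2\pi}kn$ mod $2\pi$. Put $J(z,x,y)=(\bar z,x,-y)$. **Amplitude.** Let $\mathcal K$ be a finite 4-dimensional simplicial complex, made of 4-simplices such that each tetrahedron lies in at most two of them; it is internal if it lies in two and boundary otherwise, and a triangle is internal if it lies in no boundary tetrahedron. Label the vertices of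 each 4-simplex by $1,\dots,5$; its tetrahedron $a$ is the one opposite to the vertex $a$, and $j_{ab}$ is the spin of the triangle shared by its tetrahedra $a$ and $b$. Order the two 4-simplices at each internal tetrahedron. Fix spins $j_f\in\{0,\frac12,\dots,\frac{k-1}2\}$ on boundary triangles and flat connections as above on boundary tetrahedra, arbitrary complex face amplitudes $A_f(j_f)$, and, for each internal tetrahedron $e$, an edge amplitude $A_e(\vec j,\vec\xi_e,\vec\xi'_e)$ that is continuous on the product of the moduli spaces attached to $e$ in its first and in its second 4-simplex. In $A_v$ the label at a tetrahedron is $\rho^{(a)}_{\vec j,\vec\xi}$, except that it is $J\rho^{(a)}_{\vec j,\vec\xi'}$ in the second 4-simplex of an internal tetrahedron. The spinfoam amplitude is $$A={\sum_{\{j_f\}}}'\ \prod_fA_f(j_f)\int[d\xi\,d\xi']\prod_eA_e(\vec j,\vec\xi_e,\vec\xi'_e)\prod_vA_v ,$$ where $j_f\in\{0,\frac12,\dots,\frac{k-1}2\}$ is summed over internal triangles, restricted to configurations for which at every tetrahedron the moduli space $\widetilde{\mathcal M}_{\vec j}$ contains a nondegenerate 4-gon ($v_1,\dots,v_4$ linearly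 independent in $\mathbb R^4$; equivalently $\dim\widetilde{\mathcal M}_{\vec j}=2$), and the integral is over $(\theta,\phi)$, $(\theta',\phi')$ for every internal tetrahedron. **Theorem.** For every such $\mathcal K$ and all such data the amplitude $A$ is finite: the integrals defining $\mathcal Z$ and $A_v$ converge absolutely; the sum over spins is finite; for each spin configuration in it the integral $\int[d\xi\,d\xi']$ is over a compact domain and converges absolutely; hence $A$ is a well-defined complex number and $\sum'\prod_f|A_f|\int[d\xi\,d\xi']\,\big|\prod_eA_e\prod_vA_v\big|<\infty$. -/

import Mathlib

/-!
Conventions: spins are recorded by the natural numbers `d = 2 j`, so that `0 ≤ j ≤ (k - 1) / 2`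
reads `d < k`. The ten annuli are ordered `12, 13, 14, 15, 23, 24, 25, 34, 35, 45` and occupy the
indices `0, …, 9` of `Fin 15`; the five four-holed spheres occupy the indices `10, …, 14`. The
octahedron coordinates `X₁, Y₁, Z₁, …, X₅, Y₅, Z₅` are numbered `0, …, 14`.
-/

namespace Spinfoam

open MeasureTheory

noncomputable section

/-! ### The ideal tetrahedron and the ideal octahedron -/

/-- `Q = b + b⁻¹` (a real number, as `‖b‖ = 1`). -/
def Qb (b : ℂ) : ℝ := (b + b⁻¹).re

/-- `q = exp ((2πi/k) (1 + b²))`. -/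
def qPar (k : ℕ) (b : ℂ) : ℂ := Complex.exp (2 * Real.pi * Complex.I / k * (1 + b ^ 2))

/-- `q̃ = exp ((2πi/k) (1 + b⁻²))`. -/
def qTil (k : ℕ) (b : ℂ) : ℂ := Complex.exp (2 * Real.pi * Complex.I / k * (1 + b⁻¹ ^ 2))

/-- `z = exp ((2πi/k) (-i b μ - m))`. -/
def zPar (k : ℕ) (b μ : ℂ) (m : ZMod k) : ℂ :=
  Complex.exp (2 * Real.pi * Complex.I / k * (-Complex.I * b * μ - (m.val : ℂ)))

/-- `z̃ = exp ((2πi/k) (-i b⁻¹ μ + m))`. -/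
def zTil (k : ℕ) (b μ : ℂ) (m : ZMod k) : ℂ :=
  Complex.exp (2 * Real.pi * Complex.I / k * (-Complex.I * b⁻¹ * μ + (m.val : ℂ)))

/-- `∏_{j ≥ 0} (1 - x q^j)`. -/
def qPoch (x q : ℂ) : ℂ := ∏' j : ℕ, (1 - x * q ^ j)

open Classical in
/-- The quantum dilogarithm `Ψ_Δ(μ | m)`. -/
def qDilog (k : ℕ) (b μ : ℂ) (m : ZMod k) : ℂ :=
  if ‖qPar k b‖ < 1 then
    qPoch (qPar k b * (zPar k b μ m)⁻¹) (qPar k b) /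
      qPoch (zTil k b μ m)⁻¹ (qTil k b)⁻¹
  else
    qPoch (qTil k b * (zTil k b μ m)⁻¹) (qTil k b) /
      qPoch (zPar k b μ m)⁻¹ (qPar k b)⁻¹

/-- The octahedron partition function. -/
def Zoct (k : ℕ) (b : ℂ) (μ : Fin 3 → ℂ) (m : Fin 3 → ZMod k) : ℂ :=
  (∏ i, qDilog k b (μ i) (m i)) *
    qDilog k b (Complex.I * (Qb b : ℂ) - ∑ i, μ i) (-∑ i, m i)

/-- Positive angle structures of the ideal octahedron. The last family of inequalities ensures
decay of `exp (-(2π/k) ∑ βᵢ μᵢ) Zoct (μ + i α)` along the directions `eᵢ - eⱼ`. -/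
def OctAngle (Q : ℝ) (α β : Fin 3 → ℝ) : Prop :=
  (∀ i, 0 < α i) ∧ ∑ i, α i < Q ∧ (∀ i, α i + β i < Q / 2) ∧
    (∀ i, Q / 2 < ∑ l, α l + β i) ∧ ∀ i j, i ≠ j → α j + β j - β i < Q / 2

/-! ### The graph complement in the three-sphere -/

/-- The upper left block of the symplectic matrix. -/
def matA : Matrix (Fin 15) (Fin 15) ℤ :=
  !![0, 0, 0, 0, 0, 0, 1, 1, 0, 1, 1, 0, 1, 1, 0;
    0, 0, 0, 1, 1, 0, 0, 0, 0, 0, 0, 0, 1, 1, 2;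
    0, 0, 0, 0, 0, 0, 1, 1, 2, 0, 0, 0, 0, 0, 0;
    0, 0, 0, 1, 1, 2, 0, 0, 0, 1, 1, 2, 0, 0, 0;
    0, 0, 0, 0, 0, 0, 0, 0, 0, 1, -1, 0, 0, 0, 0;
    -1, -1, 0, 0, 0, 0, 0, 0, 0, 0, 0, 0, 1, -1, 0;
    1, -1, 0, 0, 0, 0, 1, -1, 0, 0, 0, 0, 0, 0, 0;
    -1, -1, -2, 1, -1, 0, 0, 0, 0, 0, 0, 0, 1, 1, 0;
    1, 1, 0, 0, 0, 0, 0, 0, 0, -1, -1, 0, 0, 0, 0;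
    0, 0, 0, -1, -1, 0, 1, 1, 0, 0, 0, 0, 0, 0, 0;
    0, 0, 0, 0, 0, -1, 0, 0, 0, 0, 0, 0, 0, 0, 1;
    -1, 0, 0, 0, 0, 0, 0, 0, 0, 0, 0, 0, 1, 0, 0;
    -1, -1, -1, 0, 0, 0, 0, 0, 0, 0, 0, 0, 1, 1, 1;
    1, 1, 1, 0, 0, 0, 0, 0, 0, 0, 0, 0, -1, 0, 0;
    -1, 0, 0, 0, 0, 0, 0, 0, 0, 1, 1, 1, 0, 0, 0]

/-- The upper right block of the symplectic matrix. -/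
def matB : Matrix (Fin 15) (Fin 15) ℤ :=
  !![0, 0, 0, 0, 0, 0, 0, 1, 0, 0, 1, 0, 0, 1, 0;
    0, 0, 0, 0, 1, 0, 0, 0, 0, 0, 1, -1, 0, 0, 1;
    0, 0, 0, 0, 1, -1, 0, 0, 1, 0, 0, 0, 0, 1, -1;
    0, 0, 0, 0, 0, 1, 0, 1, -1, 0, 0, 1, 0, 0, 0;
    -1, 0, 0, 0, 0, 0, 0, 0, 0, 1, -1, 0, -1, 0, 0;
    0, -1, 0, 0, 0, 0, -1, 0, 0, 0, 0, 0, 1, -1, 0;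
    1, -1, 0, 0, 0, 0, 1, -1, 0, -1, 0, 0, 0, 0, 0;
    0, 0, -1, 1, -1, 0, 0, 0, 0, 0, 0, 0, 1, 0, -1;
    1, 0, -1, -1, 0, 0, 0, 0, 0, -1, 0, 1, 0, 0, 0;
    0, 1, -1, -1, 0, 1, 1, 0, -1, 0, 0, 0, 0, 0, 0;
    0, 0, 0, 0, 1, -1, 0, 0, 0, 0, 0, 0, 0, 0, 0;
    -1, 0, 0, 0, 0, 0, 0, 0, 0, 0, 0, 0, 0, 0, 0;
    0, 0, 0, 0, 0, 0, 0, 0, 0, 0, 0, 0, 1, 0, 0;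
    0, 0, 1, 0, 0, 0, 0, 0, 0, 0, 0, 0, -1, 1, 0;
    -1, 1, 0, 0, 0, 0, 0, 0, 0, 1, 0, 0, 0, 0, 0]

/-- The affine shift. -/
def vecT : Fin 15 → ℤ := ![-3, -3, -2, -4, 0, 1, 0, 1, 0, 0, 1, 1, 1, 0, 0]

/-- The symmetric integer matrix `A Bᵀ`. -/
def matS : Matrix (Fin 15) (Fin 15) ℤ := matA * matB.transpose

/-- The index of the `i`-th coordinate of the `a`-th octahedron. -/
def octIdx (a : Fin 5) (i : Fin 3) : Fin 15 := ⟨3 * a + i, by omega⟩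

/-- Positive angle structures of the graph complement: the image of products of octahedral angle
structures under the affine symplectic transformation with blocks `A`, `B`, `-(Bᵀ)⁻¹`, `0` and
shift `(Q/2) t`. -/
def PosAngle (b : ℂ) (α β : Fin 15 → ℝ) : Prop :=
  ∃ α₀ β₀ : Fin 15 → ℝ,
    (∀ a, OctAngle (Qb b) (fun i => α₀ (octIdx a i)) (fun i => β₀ (octIdx a i))) ∧
    α = (matA.map (Int.cast : ℤ → ℝ)).mulVec α₀ + (matB.map (Int.cast : ℤ → ℝ)).mulVec β₀ +
      (fun I => Qb b / 2 * (vecT I : ℝ)) ∧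
    β = -((matB.map (Int.cast : ℤ → ℝ)).transpose⁻¹).mulVec α₀

/-- The product of five octahedron partition functions. -/
def Zprod (k : ℕ) (b : ℂ) (μ : Fin 15 → ℂ) (m : Fin 15 → ZMod k) : ℂ :=
  ∏ a : Fin 5, Zoct k b (fun i => μ (octIdx a i)) (fun i => m (octIdx a i))

/-- U-type transformation; `4 i` is the square root of `det (-B) = -16`. -/
def Z1 (k : ℕ) (b : ℂ) (μ : Fin 15 → ℂ) (m : Fin 15 → ZMod k) : ℂ :=
  4 * Complex.I *
    Zprod k b (-((matB.map (Int.cast : ℤ → ℂ)).transpose.mulVec μ))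
      (-((matB.map (Int.cast : ℤ → ZMod k)).transpose.mulVec m))

/-- The integer `m · A Bᵀ · m`, computed on representatives `0 ≤ m_I < k`. -/
def quadZ {k : ℕ} (m : Fin 15 → ZMod k) : ℤ :=
  dotProduct (fun I => ((m I).val : ℤ)) (matS.mulVec fun I => ((m I).val : ℤ))

/-- T-type transformation. -/
def Z2 (k : ℕ) (b : ℂ) (μ : Fin 15 → ℂ) (m : Fin 15 → ZMod k) : ℂ :=
  (-1 : ℂ) ^ quadZ m *
    Complex.exp (Complex.I * Real.pi / k *
      (-dotProduct μ ((matS.map (Int.cast : ℤ → ℂ)).mulVec μ) + (quadZ m : ℂ))) *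
    Z1 k b μ m

/-- The integrand of the S-type transformation, on the contour `Im ν = β`. -/
def stInt (k : ℕ) (b : ℂ) (β : Fin 15 → ℝ) (μ : Fin 15 → ℂ) (m n : Fin 15 → ZMod k)
    (ν : Fin 15 → ℝ) : ℂ :=
  Complex.exp (2 * Real.pi * Complex.I / k *
      (-(∑ I, μ I * ((ν I : ℂ) + β I * Complex.I)) + ∑ I, ((m I).val : ℂ) * ((n I).val : ℂ))) *
    Z2 k b (fun I => (ν I : ℂ) + β I * Complex.I) n

/-- S-type transformation. -/
def Z3 (k : ℕ) [NeZero k] (b : ℂ) (β : Fin 15 → ℝ) (μ : Fin 15 → ℂ) (m : Fin 15 → ZMod k) : ℂ :=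
  1 / (k : ℂ) ^ 15 * ∑ n : Fin 15 → ZMod k, ∫ ν : Fin 15 → ℝ, stInt k b β μ m n ν

/-- The shifted argument `μ - (i Q / 2) t`. -/
def shiftArg (b : ℂ) (μ : Fin 15 → ℂ) : Fin 15 → ℂ :=
  fun I => μ I - Complex.I * (Qb b : ℂ) / 2 * (vecT I : ℂ)

/-- The Chern-Simons partition function of the graph complement. -/
def ZS3 (k : ℕ) [NeZero k] (b : ℂ) (β : Fin 15 → ℝ) (μ : Fin 15 → ℂ) (m : Fin 15 → ZMod k) : ℂ :=
  Z3 k b β (shiftArg b μ) m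

/-! ### Coherent states and the vertex amplitude -/

/-- The coherent state `ψ_z` of `L²(ℝ)`, including the prefactor `exp (-√2 β Re z)`. -/
def cohR (k : ℕ) (β : ℝ) (z : ℂ) (μ : ℝ) : ℂ :=
  ((Real.exp (-Real.sqrt 2 * β * z.re) * (2 / (k : ℝ)) ^ (1 / 4 : ℝ) *
      Real.exp (-Real.pi / k * (μ - k / (Real.pi * Real.sqrt 2) * z.re) ^ 2) : ℝ) : ℂ) *
    Complex.exp (Complex.I * (Real.sqrt 2 * μ * z.im : ℝ))

/-- The coherent state `ξ_(x,y)` of `ℂ^k`. -/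
def cohZ (k : ℕ) (x y : ℝ) (m : ZMod k) : ℂ :=
  (((2 / (k : ℝ)) ^ (1 / 4 : ℝ) : ℝ) : ℂ) *
    Complex.exp (-Complex.I * k * x * y / (4 * Real.pi)) *
    ∑' n : ℤ,
      Complex.exp (-(k : ℂ) / (4 * Real.pi) *
        (2 * Real.pi * (m.val : ℂ) / k - 2 * Real.pi * n - x) ^ 2) *
      Complex.exp (-Complex.I * k / (2 * Real.pi) * y *
        (2 * Real.pi * (m.val : ℂ) / k - 2 * Real.pi * n - x))

/-- A coherent state label `(z, x, y)` of one four-holed sphere. -/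
structure CohLabel where
  z : ℂ
  x : ℝ
  y : ℝ

/-- The involution `J (z, x, y) = (z̄, x, -y)`. -/
def CohLabel.J (ρ : CohLabel) : CohLabel := ⟨(starRingEnd ℂ) ρ.z, ρ.x, -ρ.y⟩

/-- The index of the annulus joining the `a`-th and the `b`-th sphere (the value at `a = b` is
never used). -/
def annIdx (a b : Fin 5) : Fin 15 :=
  (!![0, 0, 1, 2, 3; 0, 0, 4, 5, 6; 1, 4, 0, 7, 8; 2, 5, 7, 0, 9; 3, 6, 8, 9, 0] :
    Matrix (Fin 5) (Fin 5) (Fin 15)) a b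

/-- The pair of spheres joined by an annulus. -/
def annPair : Fin 10 → Fin 5 × Fin 5 :=
  ![(0, 1), (0, 2), (0, 3), (0, 4), (1, 2), (1, 3), (1, 4), (2, 3), (2, 4), (3, 4)]

/-- The index of the `a`-th four-holed sphere. -/
def sphIdx (a : Fin 5) : Fin 15 := ⟨10 + a, by omega⟩

/-- `ε_I = (1 - (-1)^{t_I}) / 2` if `k` is odd, and `0` if `k` is even. -/
def eps (k : ℕ) (I : Fin 15) : ℤ := if Odd k ∧ Odd (vecT I) then 1 else 0

/-- The residue `m_ab` with `-(m_ab + t_ab k / 2) = 2 j_ab + ε_ab / 2` modulo `k`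
(`t_ab k + ε_ab` is even). -/
def annM (k : ℕ) (d : Fin 5 → Fin 5 → ℕ) (I : Fin 10) : ZMod k :=
  -(d (annPair I).1 (annPair I).2 : ZMod k) -
    (((vecT (I.castLE (by omega)) * k + eps k (I.castLE (by omega))) / 2 : ℤ) : ZMod k)

/-- Ten annulus entries followed by five sphere entries. -/
def joinVec {X : Type} (u : Fin 10 → X) (v : Fin 5 → X) : Fin 15 → X :=
  Fin.append (m := 10) (n := 5) u v

/-- The integrand of the vertex amplitude, at `Re μ_ab = 0`. -/
def vertexInt (k : ℕ) [NeZero k] (b : ℂ) (α β : Fin 15 → ℝ) (d : Fin 5 → Fin 5 → ℕ)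
    (ρ : Fin 5 → CohLabel) (m : Fin 5 → ZMod k) (μ : Fin 5 → ℝ) : ℂ :=
  ZS3 k b β (fun I => ((joinVec (fun _ => 0) μ I : ℝ) : ℂ) + α I * Complex.I) (joinVec (annM k d) m) *
    ∏ a, cohR k (β (sphIdx a)) (ρ a).z (μ a) * cohZ k (ρ a).x (ρ a).y (m a)

/-- The vertex amplitude `A_v` as a function of the spins and of the coherent state labels. -/
def vertexAmp (k : ℕ) [NeZero k] (b : ℂ) (α β : Fin 15 → ℝ) (d : Fin 5 → Fin 5 → ℕ)
    (ρ : Fin 5 → CohLabel) : ℂ :=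
  ∑ m : Fin 5 → ZMod k, ∫ μ : Fin 5 → ℝ, vertexInt k b α β d ρ m μ

/-! ### Flat `SU(2)` connections on the four-holed sphere -/

/-- Four `2 × 2` matrices, the holonomies `H₁, …, H₄` around the holes. -/
abbrev Hol : Type := Fin 4 → Matrix (Fin 2) (Fin 2) ℂ

/-- Simultaneous conjugation by `SU(2)`. -/
def holSetoid : Setoid Hol where
  r H H' := ∃ g ∈ Matrix.specialUnitaryGroup (Fin 2) ℂ, ∀ i, H' i = g * H i * star g
  iseqv := by
    refine ⟨fun H => ⟨1, one_mem _, fun i => by simp⟩, ?_, ?_⟩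
    · rintro H H' ⟨g, hg, h⟩
      have hu : star g * g = 1 := Matrix.mem_unitaryGroup_iff'.1 hg.1
      refine ⟨star g, (star (⟨g, hg⟩ : Matrix.specialUnitaryGroup (Fin 2) ℂ)).2, fun i => ?_⟩
      rw [h i, star_star]
      calc H i = (star g * g) * H i * (star g * g) := by simp [hu]
        _ = star g * (g * H i * star g) * g := by simp only [Matrix.mul_assoc]
    · rintro H H' H'' ⟨g, hg, h⟩ ⟨g', hg', h'⟩
      refine ⟨g' * g, mul_mem hg' hg, fun i => ?_⟩
      rw [h' i, h i, star_mul]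
      simp only [Matrix.mul_assoc]

/-- Conjugacy classes of holonomies, with the quotient topology. -/
def HolClass : Type := Quotient holSetoid

instance : TopologicalSpace HolClass :=
  inferInstanceAs (TopologicalSpace (Quotient holSetoid))

/-- The conjugacy class of holonomies. -/
def holMk (H : Hol) : HolClass := Quotient.mk holSetoid H

/-- Solutions in `SU(2)` of `H₄ H₃ H₂ H₁ = 1` in which `Hᵢ` has the eigenvalues
`exp (± 2πi jᵢ / k)`, where `2 jᵢ = d i`. -/
def su2Conn (k : ℕ) (d : Fin 4 → ℕ) : Set Hol :=
  {H | (∀ i, H i ∈ Matrix.specialUnitaryGroup (Fin 2) ℂ ∧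
      (H i).trace = ((2 * Real.cos (Real.pi * d i / k) : ℝ) : ℂ)) ∧
    H 3 * H 2 * H 1 * H 0 = 1}

/-- The moduli space of flat `SU(2)` connections on the four-holed sphere. -/
def su2Moduli (k : ℕ) (d : Fin 4 → ℕ) : Set HolClass := holMk '' su2Conn k d

/-- The moduli space contains a nondegenerate 4-gon, i.e. one whose vertices
`1, H₁, H₂ H₁, H₃ H₂ H₁` are linearly independent over `ℝ`; this says that the moduli space
has dimension two. -/
def HasNondegenerate (k : ℕ) (d : Fin 4 → ℕ) : Prop :=
  ∃ H ∈ su2Conn k d, LinearIndependent ℝ ![1, H 0, H 1 * H 0, H 2 * H 1 * H 0]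

/-- The edge lengths `aᵢ = 2π jᵢ / k` of the 4-gon. -/
def edgeLen (k : ℕ) (d : Fin 4 → ℕ) (i : Fin 4) : ℝ := Real.pi * d i / k

/-- The compact range of the coordinates `(θ, φ)`: the diagonal length `θ` satisfies the spherical
triangle inequalities with `a₁, a₂` and with `a₃, a₄`; `|φ|` is the bending angle and the sign of
`φ` is the orientation of the bending. -/
def polyDomain (k : ℕ) (d : Fin 4 → ℕ) : Set (ℝ × ℝ) :=
  Set.Icc
      (max |edgeLen k d 0 - edgeLen k d 1| |edgeLen k d 2 - edgeLen k d 3|)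
      (min (min (edgeLen k d 0 + edgeLen k d 1)
            (2 * Real.pi - edgeLen k d 0 - edgeLen k d 1))
        (min (edgeLen k d 2 + edgeLen k d 3)
            (2 * Real.pi - edgeLen k d 2 - edgeLen k d 3))) ×ˢ
    Set.Icc (-Real.pi) Real.pi

/-- The matrix `v⁰ + i (v¹ σ₁ + v² σ₂ + v³ σ₃)`. -/
def quat (v : Fin 4 → ℝ) : Matrix (Fin 2) (Fin 2) ℂ :=
  !![(v 0 : ℂ) + v 3 * Complex.I, (v 2 : ℂ) + v 1 * Complex.I;
    -(v 2 : ℂ) + v 1 * Complex.I, (v 0 : ℂ) - v 3 * Complex.I]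

/-- The angle opposite to the side `r` in a spherical triangle with sides `p`, `θ`, `r`. -/
def sphAngle (p θ r : ℝ) : ℝ :=
  Real.arccos ((Real.cos r - Real.cos p * Real.cos θ) / (Real.sin p * Real.sin θ))

/-- The holonomies of the 4-gon in `SU(2)` with vertices `v₁ = 1, v₂, v₃, v₄`, edge lengths
`a₁, …, a₄`, diagonal length `d(v₁, v₃) = θ` and bending angle `φ` along that diagonal, in the
gauge where `v₃` lies in the direction of `σ₃` and `v₂` in the half-plane of positive `σ₁`. -/
def polygon (k : ℕ) (d : Fin 4 → ℕ) (p : ℝ × ℝ) : Hol :=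
  let a := edgeLen k d
  let A := sphAngle (a 0) p.1 (a 1)
  let B := sphAngle (a 3) p.1 (a 2)
  let v₂ := quat ![Real.cos (a 0), Real.sin (a 0) * Real.sin A, 0, Real.sin (a 0) * Real.cos A]
  let v₃ := quat ![Real.cos p.1, 0, 0, Real.sin p.1]
  let v₄ := quat ![Real.cos (a 3), Real.sin (a 3) * (Real.sin B * Real.cos p.2),
    Real.sin (a 3) * (Real.sin B * Real.sin p.2), Real.sin (a 3) * Real.cos B]
  ![v₂, v₃ * v₂⁻¹, v₄ * v₃⁻¹, v₄⁻¹]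

/-! ### Coherent state labels of flat connections -/

open Classical in
/-- An eigenvector (unique up to scaling) of `H ∈ SU(2)` for its eigenvalue `l ≠ l̄`. -/
def spinor (H : Matrix (Fin 2) (Fin 2) ℂ) (l : ℂ) : Fin 2 → ℂ :=
  if H 0 1 ≠ 0 then ![H 0 1, l - H 0 0] else if H 0 0 = l then ![1, 0] else ![0, 1]

/-- `J ξ = (-ξ̄², ξ̄¹)`. -/
def spinorJ (ξ : Fin 2 → ℂ) : Fin 2 → ℂ := ![-(starRingEnd ℂ) (ξ 1), (starRingEnd ℂ) (ξ 0)]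

/-- The matrix `M(ξ)` with columns `ξ` and `J ξ`. -/
def spinorM (ξ : Fin 2 → ℂ) : Matrix (Fin 2) (Fin 2) ℂ :=
  !![ξ 0, -(starRingEnd ℂ) (ξ 1); ξ 1, (starRingEnd ℂ) (ξ 0)]

/-- The invariant area form on `ℂ²`. -/
def wedge (u v : Fin 2 → ℂ) : ℂ := u 0 * v 1 - u 1 * v 0

/-- The Fock-Goncharov coordinate of the diagonal `d₁ d₂` of a quadrilateral with framing flags
`r₁, d₁, r₂, d₂` in cyclic order. -/
def fgCoord (r₁ d₁ r₂ d₂ : Fin 2 → ℂ) : ℂ :=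
  wedge r₁ d₁ * wedge d₂ r₂ / (wedge r₁ d₂ * wedge d₁ r₂)

/-- The holes `1, 2, 3, 4` of the `a`-th sphere, named by the spheres to which their annuli lead.
The position coordinate belongs to the edge `24`; the momentum coordinate belongs to the
edge `14`, except for the fourth sphere (`a = 3`), where it is minus that of the edge `34`. -/
def hole (a : Fin 5) : Fin 4 → Fin 5 :=
  (![![2, 4, 3, 1], ![3, 4, 2, 0], ![3, 0, 1, 4], ![1, 0, 2, 4], ![2, 0, 1, 3]] :
    Fin 5 → Fin 4 → Fin 5) a

/-- The framing flags `ξ'ᵢ` at the base point: `ξᵢ` or `J ξᵢ`, according to the direction of the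
annulus. -/
def flag (k : ℕ) (a : Fin 5) (d : Fin 4 → ℕ) (H : Hol) (i : Fin 4) : Fin 2 → ℂ :=
  let ξ := spinor (H i) (Complex.exp (Complex.I * (Real.pi * d i / k : ℝ)))
  if a < hole a i then ξ else spinorJ ξ

/-- The holonomy around the fourth hole, with squared eigenvalue
`exp ((2πi/k) (b α_ab + 2 j_ab + ε_ab / 2))` on the framing flag. -/
def hol4 (k : ℕ) (b : ℂ) (α : Fin 15 → ℝ) (a : Fin 5) (d : Fin 4 → ℕ) (H : Hol) :
    Matrix (Fin 2) (Fin 2) ℂ :=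
  let I := annIdx a (hole a 3)
  let L : ℂ := Real.pi * Complex.I / k * (b * α I + (d 3 : ℂ) + (eps k I : ℂ) / 2)
  let M := spinorM (flag k a d H 3)
  M * Matrix.diagonal ![Complex.exp L, Complex.exp (-L)] * M⁻¹

/-- `exp 𝒳_a`. -/
def expX (k : ℕ) (a : Fin 5) (d : Fin 4 → ℕ) (H : Hol) : ℂ :=
  let s := flag k a d H
  fgCoord (s 0) (s 1) (s 2) (s 3)

/-- `exp 𝒴_a`. -/
def expY (k : ℕ) (b : ℂ) (α : Fin 15 → ℝ) (a : Fin 5) (d : Fin 4 → ℕ) (H : Hol) : ℂ :=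
  let s := flag k a d H
  let O := hol4 k b α a d H
  if a = 3 then (fgCoord (s 1) (s 2) (O⁻¹.mulVec (s 0)) (s 3))⁻¹
  else fgCoord (O.mulVec (s 2)) (s 0) (s 1) (s 3)

/-- The real `μ` with `w = (2πi/k) (-i b μ - m)` for some real `m`. -/
def muOf (k : ℕ) (b w : ℂ) : ℝ := k * w.re / (2 * Real.pi * b.re)

/-- The real `m` with `w = (2πi/k) (-i b μ - m)` for some real `μ`. -/
def mOf (k : ℕ) (b w : ℂ) : ℝ := b.im * muOf k b w - k * w.im / (2 * Real.pi)

/-- The coherent state label `ρ = (z, x, y)` of a flat connection on the `a`-th sphere. The angles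
`x, y ∈ [0, 2π)` do not depend on the branch of the logarithm. -/
def cohLabel (k : ℕ) (b : ℂ) (α : Fin 15 → ℝ) (a : Fin 5) (d : Fin 4 → ℕ) (H : Hol) :
    CohLabel :=
  let X := Complex.log ((-1) ^ vecT (sphIdx a) * expX k a d H)
  let Y := Complex.log (expY k b α a d H)
  { z := ((2 * Real.pi / k / Real.sqrt 2 : ℝ) : ℂ) *
      ((muOf k b X : ℂ) + (muOf k b Y : ℂ) * Complex.I)
    x := toIcoMod Real.two_pi_pos 0 (2 * Real.pi / k * mOf k b X)
    y := toIcoMod Real.two_pi_pos 0 (2 * Real.pi / k * mOf k b Y) }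

/-! ### Four-dimensional simplicial complexes -/

section Complex4

variable {V : Type*} [Fintype V] [DecidableEq V]

/-- The number of 4-simplices of `K` containing `e`. -/
def cellCount (K : PreAbstractSimplicialComplex V) (e : Finset V) : ℕ :=
  {σ : Finset V | σ ∈ K.faces ∧ σ.card = 5 ∧ e ⊆ σ}.ncard

/-- `K` is made of 4-simplices glued in pairs along tetrahedra. -/
structure IsComplex4 (K : PreAbstractSimplicialComplex V) : Prop where
  pure : ∀ s ∈ K.faces, ∃ σ ∈ K.faces, σ.card = 5 ∧ s ⊆ σ
  card_le : ∀ s ∈ K.faces, s.card ≤ 5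
  glued : ∀ e ∈ K.faces, e.card = 4 → cellCount K e ≤ 2

/-- The 4-simplices. -/
def Cell (K : PreAbstractSimplicialComplex V) : Type _ :=
  {σ : Finset V // σ ∈ K.faces ∧ σ.card = 5}

/-- The triangles. -/
def Face (K : PreAbstractSimplicialComplex V) : Type _ :=
  {f : Finset V // f ∈ K.faces ∧ f.card = 3}

/-- A tetrahedron is internal if it is shared by two 4-simplices. -/
def IsInternalTet (K : PreAbstractSimplicialComplex V) (e : Finset V) : Prop :=
  e ∈ K.faces ∧ e.card = 4 ∧ cellCount K e = 2

/-- A triangle is internal if it lies in no tetrahedron of the boundary. -/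
def IsInternalFace (K : PreAbstractSimplicialComplex V) (f : Finset V) : Prop :=
  f ∈ K.faces ∧ f.card = 3 ∧ ∀ e ∈ K.faces, e.card = 4 → cellCount K e = 1 → ¬ f ⊆ e

/-- The internal tetrahedra. -/
def IntTet (K : PreAbstractSimplicialComplex V) : Type _ := {e : Finset V // IsInternalTet K e}

/-- The internal triangles. -/
def IntFace (K : PreAbstractSimplicialComplex V) : Type _ := {f : Finset V // IsInternalFace K f}

instance (K : PreAbstractSimplicialComplex V) : Fintype (Cell K) := by
  unfold Cell; exact Fintype.ofFinite _

instance (K : PreAbstractSimplicialComplex V) : Fintype (Face K) := by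
  unfold Face; exact Fintype.ofFinite _

instance (K : PreAbstractSimplicialComplex V) : Fintype (IntTet K) := by
  unfold IntTet; exact Fintype.ofFinite _

/-- The tetrahedron opposite to the `a`-th vertex of a 4-simplex with labelled vertices. -/
def tet {K : PreAbstractSimplicialComplex V} (label : ∀ σ : Cell K, Fin 5 ≃ σ.1)
    (h : Cell K × Fin 5) : Finset V :=
  h.1.1.erase (label h.1 h.2)

/-- The combinatorial choices entering the amplitude: a labelling of the five vertices (hence of the
five boundary tetrahedra) of each 4-simplex, and an ordering of the two 4-simplices meeting
at each internal tetrahedron. -/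
structure Gluing (K : PreAbstractSimplicialComplex V) where
  label : ∀ σ : Cell K, Fin 5 ≃ σ.1
  fst : IntTet K → Cell K × Fin 5
  snd : IntTet K → Cell K × Fin 5
  tet_fst : ∀ e, tet label (fst e) = e.1
  tet_snd : ∀ e, tet label (snd e) = e.1
  fst_ne_snd : ∀ e, (fst e).1 ≠ (snd e).1

variable {K : PreAbstractSimplicialComplex V}

/-- The triangle shared by the `a`-th and the `b`-th tetrahedron of a 4-simplex. -/
def Gluing.tri (G : Gluing K) (σ : Cell K) (a b : Fin 5) : Finset V :=
  (σ.1.erase (G.label σ a)).erase (G.label σ b)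

open Classical in
/-- The spins (doubled) of all triangles: `c` on the internal ones, `jb` on the boundary. -/
def spin (jb : Finset V → ℕ) (c : IntFace K → ℕ) (f : Finset V) : ℕ :=
  if h : IsInternalFace K f then c ⟨f, h⟩ else jb f

/-- The four spins (doubled) of a tetrahedron of a 4-simplex, in the order of the holes. -/
def Gluing.tetSpin (G : Gluing K) (j : Finset V → ℕ) (h : Cell K × Fin 5) (i : Fin 4) : ℕ :=
  j (G.tri h.1 h.2 (hole h.2 i))

/-- A point of the integration domain is a family of coordinates `((θ, φ), (θ', φ'))`, one pair of
4-gons for each internal tetrahedron. -/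
abbrev GonCoord (K : PreAbstractSimplicialComplex V) : Type _ := IntTet K → (ℝ × ℝ) × (ℝ × ℝ)

/-- The integration domain for given spins. -/
def Gluing.domain (G : Gluing K) (k : ℕ) (j : Finset V → ℕ) : Set (GonCoord K) :=
  Set.univ.pi fun e =>
    polyDomain k (G.tetSpin j (G.fst e)) ×ˢ polyDomain k (G.tetSpin j (G.snd e))

open Classical in
/-- The flat connection on a tetrahedron of a 4-simplex: it is given by the integration variables
if the tetrahedron is internal and by the boundary data `bd` otherwise. -/
def Gluing.hol (G : Gluing K) (k : ℕ) (j : Finset V → ℕ) (bd : Cell K × Fin 5 → Hol)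
    (p : GonCoord K) (h : Cell K × Fin 5) : Hol :=
  if he : IsInternalTet K (tet G.label h) then
    polygon k (G.tetSpin j h)
      (if G.fst ⟨_, he⟩ = h then (p ⟨_, he⟩).1 else (p ⟨_, he⟩).2)
  else bd h

open Classical in
/-- The coherent state label on a tetrahedron of a 4-simplex: `ρ` on the first and `J ρ` on the
second of the two 4-simplices sharing an internal tetrahedron. -/
def Gluing.cohLabel (G : Gluing K) (k : ℕ) (b : ℂ) (α : Fin 15 → ℝ) (j : Finset V → ℕ)
    (bd : Cell K × Fin 5 → Hol) (p : GonCoord K) (h : Cell K × Fin 5) : CohLabel :=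
  let ρ := Spinfoam.cohLabel k b α h.2 (G.tetSpin j h) (G.hol k j bd p h)
  if ∃ e, G.snd e = h then ρ.J else ρ

/-- Edge amplitudes, as functions of the four spins of the tetrahedron and of two points of the
moduli spaces. -/
abbrev EdgeAmp (K : PreAbstractSimplicialComplex V) : Type _ :=
  IntTet K → (Fin 4 → ℕ) → HolClass → HolClass → ℂ

/-- The integrand `∏_e A_e ∏_v A_v`. -/
def Gluing.integrand (G : Gluing K) (k : ℕ) [NeZero k] (b : ℂ) (α β : Fin 15 → ℝ)
    (Ae : EdgeAmp K) (bd : Cell K × Fin 5 → Hol) (j : Finset V → ℕ) (p : GonCoord K) : ℂ :=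
  (∏ e : IntTet K, Ae e (G.tetSpin j (G.fst e))
      (holMk (polygon k (G.tetSpin j (G.fst e)) (p e).1))
      (holMk (polygon k (G.tetSpin j (G.snd e)) (p e).2))) *
    ∏ σ : Cell K, vertexAmp k b α β (fun a a' => j (G.tri σ a a'))
      fun a => G.cohLabel k b α j bd p (σ, a)

/-- The spin configurations of the primed sum: `0 ≤ j_f ≤ (k - 1) / 2`, and at every tetrahedron the
moduli space of flat connections exists and has dimension two. -/
def Gluing.admissible (G : Gluing K) (k : ℕ) (jb : Finset V → ℕ) : Set (IntFace K → ℕ) :=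
  {c | (∀ f, c f < k) ∧ ∀ h, HasNondegenerate k (G.tetSpin (spin jb c) h)}

/-- The contribution of one spin configuration to the amplitude. -/
def Gluing.term (G : Gluing K) (k : ℕ) [NeZero k] (b : ℂ) (α β : Fin 15 → ℝ)
    (Af : Face K → ℕ → ℂ) (Ae : EdgeAmp K) (bd : Cell K × Fin 5 → Hol) (j : Finset V → ℕ) : ℂ :=
  (∏ f : Face K, Af f (j f.1)) * ∫ p in G.domain k j, G.integrand k b α β Ae bd j p

/-- The spinfoam amplitude `A`. -/
def Gluing.amplitude (G : Gluing K) (k : ℕ) [NeZero k] (b : ℂ) (α β : Fin 15 → ℝ)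
    (Af : Face K → ℕ → ℂ) (Ae : EdgeAmp K) (jb : Finset V → ℕ) (bd : Cell K × Fin 5 → Hol) : ℂ :=
  ∑' c : G.admissible k jb, G.term k b α β Af Ae bd (spin jb c.1)

/-- The amplitude with all summands and the integrand replaced by their absolute values. -/
def Gluing.absAmplitude (G : Gluing K) (k : ℕ) [NeZero k] (b : ℂ) (α β : Fin 15 → ℝ)
    (Af : Face K → ℕ → ℂ) (Ae : EdgeAmp K) (jb : Finset V → ℕ) (bd : Cell K × Fin 5 → Hol) :
    ENNReal :=
  ∑' c : G.admissible k jb, (∏ f : Face K, ‖Af f (spin jb c.1 f.1)‖ₑ) *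
    ∫⁻ p in G.domain k (spin jb c.1), ‖G.integrand k b α β Ae bd (spin jb c.1) p‖ₑ

end Complex4

end

end Spinfoam

namespace Spinfoam

open MeasureTheory Filter Topology

/-! ### The infinite product `(x; q)_∞` -/

/-! Finiteness rests on one uniform estimate: the vertex amplitude is bounded by a constant
independent of the spins and of the labels `(z, x, y)`, as long as `x` and `y` are bounded
(`exists_norm_vertexAmp_le`). The rest is compactness and measurability.

The estimate starts from the quantum dilogarithm. On a line `Im μ = a` with `0 < a < Q` its modulus
is bounded as `Re μ → +∞` and is `O(exp((2π/k)(Q/2 - a) Re μ))` as `Re μ → -∞`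
(`exists_norm_qDilog_le`); the second rate comes from a q-difference equation. For the four factors
of an octahedron, weighted by `exp(-(2π/k) ∑ βᵢ xᵢ)`, the resulting exponent is piecewise linear on
`ℝ³`. Three families of angle inequalities say exactly that it is negative on the rays generated by
`eᵢ`, `-eᵢ` and `eᵢ - eⱼ`, which forces exponential decay in every direction (`le_of_le_on_rays`,
`exists_exp_mul_norm_Zoct_le`).

On the contour `Im ν = β`, the affine symplectic map defining positive angle structures turns the
state integrand, in the variable `x = -Bᵀν`, into five such weighted octahedra times `exp((2π/k)
u·β)`, where `u = Re μ`. So the state integral converges absolutely, and the partition function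
grows at most like `exp((2π/k) u·β)` (`exists_norm_ZS3_le`).

The Gaussians in the coherent states beat this growth. Their prefactor `exp(-√2 β Re z)` is
precisely what makes completing the square leave a constant free of `z` (`exp_mul_norm_cohR`). This
is essential: `z` is built from logarithms of cross-ratios and need not stay bounded on the moduli
space, whereas `x` and `±y` lie in `[0, 2π)`.

Finally, the coordinates range over a compact box, edge amplitudes are continuous on compact moduli
spaces, and all labels are Borel functions of the coordinates. A bounded measurable integrand on a
set of finite measure is integrable (`Gluing.integrableOn_integrand`), and only finitely many spin
configurations occur. -/

theorem summable_norm_neg_mul_pow {q : ℂ} (hq : ‖q‖ < 1) (x : ℂ) :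
    Summable fun j : ℕ => ‖-(x * q ^ j)‖ := by
  simpa using (summable_geometric_of_lt_one (norm_nonneg q) hq).mul_left ‖x‖

theorem qPoch_eq_one_add (x q : ℂ) : qPoch x q = ∏' j : ℕ, (1 + -(x * q ^ j)) := by
  simp [qPoch, sub_eq_add_neg]

theorem continuous_qPoch {q : ℂ} (hq : ‖q‖ < 1) : Continuous fun x => qPoch x q := by
  refine continuous_iff_continuousAt.2 fun x => ?_
  simp only [ContinuousAt, qPoch_eq_one_add]
  refine tendsto_tprod_one_add_of_dominated_convergence
    (bound := fun j => (‖x‖ + 1) * ‖q‖ ^ j)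
    ((summable_geometric_of_lt_one (norm_nonneg q) hq).mul_left _) (fun j => ?_) ?_
  · exact (Continuous.tendsto (by fun_prop) x)
  · filter_upwards [Metric.ball_mem_nhds x one_pos] with y hy j
    rw [norm_neg, norm_mul, norm_pow]
    gcongr
    have : ‖y - x‖ < 1 := by simpa [dist_eq_norm] using hy
    linarith [norm_le_norm_add_norm_sub' y x]

theorem qPoch_zero (q : ℂ) : qPoch 0 q = 1 := by simp [qPoch]

theorem qPoch_succ {q : ℂ} (hq : ‖q‖ < 1) (x : ℂ) :
    qPoch x q = (1 - x) * qPoch (q * x) q := by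
  have h := tprod_eq_zero_mul' (f := fun j : ℕ => (1 - x * q ^ j)) (by
    have := multipliable_one_add_of_summable (summable_norm_neg_mul_pow hq (q * x))
    refine this.congr fun j => ?_
    ring)
  rw [qPoch, h, qPoch]
  simp only [pow_zero, mul_one]
  congr 2
  ext j
  ring

/-- An absolutely convergent product vanishes only if one of its factors does. This locates the
possible poles of the dilogarithm. -/
theorem exists_of_qPoch_eq_zero {q : ℂ} (hq : ‖q‖ < 1) {x : ℂ} (h : qPoch x q = 0) :
    ∃ j : ℕ, x * q ^ j = 1 := by
  by_contra! hne
  refine tprod_one_add_ne_zero_of_summable (f := fun j : ℕ => -(x * q ^ j)) (fun j hj => hne j ?_)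
    (summable_norm_neg_mul_pow hq x) (by rwa [← qPoch_eq_one_add])
  linear_combination -hj

theorem qPoch_conj {q : ℂ} (hq : ‖q‖ < 1) (x : ℂ) :
    qPoch ((starRingEnd ℂ) x) ((starRingEnd ℂ) q) = (starRingEnd ℂ) (qPoch x q) := by
  have hm : Multipliable fun j : ℕ => 1 - x * q ^ j := by
    simpa [sub_eq_add_neg] using
      multipliable_one_add_of_summable (summable_norm_neg_mul_pow hq x)
  rw [qPoch, qPoch, hm.map_tprod (starRingEnd ℂ) Complex.continuous_conj]
  simp

/-! ### Growth along a real line -/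

/-- The errors `K exp(g x)` decay geometrically along the orbit `x, x - s, x - 2s, …`, so their sum
is bounded and only the main factors `exp(-(l s))` accumulate. The bound is uniform in `m`, which
moves along with `x`. -/
theorem le_exp_of_shift_le {F : ℝ → ℤ → ℝ} {s l K g M R : ℝ} (hs : 0 < s) (hg : 0 < g)
    (hK : 0 ≤ K) (hR : 0 ≤ R) (hF : ∀ x m, 0 ≤ F x m)
    (hbase : ∀ m, ∀ x, -R - s ≤ x → x ≤ -R → F x m ≤ M)
    (hshift : ∀ m, ∀ x ≤ -R,
      F (x - s) (m - 2) ≤ F x m * Real.exp (-(l * s)) * Real.exp (K * Real.exp (g * x))) :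
    ∃ C, ∀ m, ∀ x ≤ -R, F x m ≤ C * Real.exp (l * x) := by
  have hgs : Real.exp (-(g * s)) < 1 := by simpa using mul_pos hg hs
  -- `L` is the sum of the geometric series of errors, i.e. the solution of `K + L exp(-gs) = L`.
  -- With it, `f` below absorbs all later errors in advance and does not increase under the shift.
  set L := K / (1 - Real.exp (-(g * s))) with hL
  have hd : 0 < 1 - Real.exp (-(g * s)) := by linarith
  have hL0 : 0 ≤ L := by positivity
  have hLK : K + L * Real.exp (-(g * s)) = L := by
    rw [hL]; field_simp; ring
  set f : ℝ → ℤ → ℝ := fun x m => F x m * Real.exp (-(l * x)) * Real.exp (L * Real.exp (g * x))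
    with hf
  have hstep : ∀ m, ∀ x ≤ -R, f (x - s) (m - 2) ≤ f x m := by
    intro m x hx
    calc f (x - s) (m - 2) ≤ (F x m * Real.exp (-(l * s)) * Real.exp (K * Real.exp (g * x))) *
          Real.exp (-(l * (x - s))) * Real.exp (L * Real.exp (g * (x - s))) := by
          simp only [hf]; gcongr; exact hshift m x hx
      _ = f x m := by
          simp only [hf]
          rw [mul_assoc, mul_assoc, mul_assoc, mul_assoc, ← Real.exp_add, ← Real.exp_add,
            ← Real.exp_add, ← Real.exp_add]
          congr 2
          have : Real.exp (g * (x - s)) = Real.exp (-(g * s)) * Real.exp (g * x) := by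
            rw [← Real.exp_add]; congr 1; ring
          rw [this]
          linear_combination Real.exp (g * x) * hLK
  have hM : 0 ≤ M := (hF (-R) 0).trans (hbase 0 (-R) (by linarith) le_rfl)
  set B := M * Real.exp (|l| * (R + s)) * Real.exp L with hB
  have hall : ∀ n : ℕ, ∀ m, ∀ x, -R - s ≤ x → x ≤ -R → f (x - n * s) m ≤ B := by
    intro n
    induction n with
    | zero =>
      intro m x h1 h2
      simp only [hf, hB, Nat.cast_zero, zero_mul, sub_zero]
      have h3 : -(l * x) ≤ |l| * (R + s) := by
        calc -(l * x) ≤ |l * x| := neg_le_abs _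
          _ = |l| * |x| := abs_mul _ _
          _ ≤ |l| * (R + s) := by
            gcongr
            rw [abs_le]; constructor <;> linarith
      have h4 : L * Real.exp (g * x) ≤ L := by
        refine mul_le_of_le_one_right hL0 (Real.exp_le_one_iff.2 ?_)
        exact mul_nonpos_of_nonneg_of_nonpos hg.le (by linarith)
      have := hbase m x h1 h2
      gcongr
    | succ n ih =>
      intro m x h1 h2
      -- The shift lowers the integer label by 2, so the predecessor of `m` is `m + 2`; hence the
      -- induction is over all `m` at once.
      have h := hstep (m + 2) (x - n * s) (by nlinarith [Nat.cast_nonneg (α := ℝ) n])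
      have h' := ih (m + 2) x h1 h2
      have e : x - (n + 1 : ℕ) * s = x - n * s - s := by push_cast; ring
      rw [e]
      simpa using h.trans (by simpa using h')
  refine ⟨B, fun m x hx => ?_⟩
  -- Any `x ≤ -R` is carried into the base interval `[-R - s, -R]` by `n` backward shifts.
  obtain ⟨n, hn1, hn2⟩ : ∃ n : ℕ, n * s ≤ -R - x ∧ -R - x < (n + 1) * s := by
    refine ⟨⌊(-R - x) / s⌋₊, ?_, ?_⟩
    · have := Nat.floor_le (a := (-R - x) / s) (div_nonneg (by linarith) hs.le)
      rwa [le_div_iff₀ hs] at this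
    · have := Nat.lt_floor_add_one ((-R - x) / s)
      rwa [div_lt_iff₀ hs] at this
  have h := hall n m (x + n * s) (by linarith) (by linarith)
  rw [add_sub_cancel_right] at h
  have h1 : F x m * Real.exp (-(l * x)) ≤ f x m :=
    le_mul_of_one_le_right (mul_nonneg (hF x m) (Real.exp_pos _).le)
      (Real.one_le_exp (mul_nonneg hL0 (Real.exp_pos _).le))
  calc F x m = F x m * Real.exp (-(l * x)) * Real.exp (l * x) := by
        rw [mul_assoc, ← Real.exp_add]; simp
    _ ≤ B * Real.exp (l * x) := by gcongr; exact h1.trans h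

/-! ### The quantum dilogarithm on horizontal lines -/

noncomputable section

/-- The value of `z⁻¹` on the real line. -/
def dilW (k : ℕ) (c : ℂ) (x : ℝ) (m : ℤ) : ℂ :=
  Complex.exp (2 * Real.pi * Complex.I / k * (Complex.I * c * x + m))

/-- The effect on `z` of an imaginary shift of the argument. -/
def dilE (k : ℕ) (c : ℂ) (a : ℝ) : ℂ := Complex.exp (2 * Real.pi * Complex.I / k * (c * a))

/-- The modulus of the quantum dilogarithm. -/
def dilNorm (k : ℕ) (c : ℂ) (a x : ℝ) (m : ℤ) : ℝ :=
  ‖qPoch (qPar k c * (dilW k c x m / dilE k c a)) (qPar k c)‖ /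
    ‖qPoch (dilW k c x m * dilE k c a) (qPar k c)‖

end

theorem norm_exp_two_pi_I_div (k : ℕ) (u : ℂ) :
    ‖Complex.exp (2 * Real.pi * Complex.I / k * u)‖ = Real.exp (-(2 * Real.pi / k) * u.im) := by
  rw [Complex.norm_exp]
  congr 1
  have : (2 * Real.pi * Complex.I / k * u : ℂ) = ((2 * Real.pi / k : ℝ) : ℂ) * (Complex.I * u) := by
    push_cast; ring
  rw [this, Complex.re_ofReal_mul]
  simp

theorem norm_dilW (k : ℕ) (c : ℂ) (x : ℝ) (m : ℤ) :
    ‖dilW k c x m‖ = Real.exp (-(2 * Real.pi / k * c.re * x)) := by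
  rw [dilW, norm_exp_two_pi_I_div]
  simp [mul_assoc]

theorem norm_dilE (k : ℕ) (c : ℂ) (a : ℝ) :
    ‖dilE k c a‖ = Real.exp (-(2 * Real.pi / k * c.im * a)) := by
  rw [dilE, norm_exp_two_pi_I_div]
  simp [mul_assoc]

theorem norm_qPar (k : ℕ) (c : ℂ) :
    ‖qPar k c‖ = Real.exp (-(2 * Real.pi / k * (2 * c.re * c.im))) := by
  have h : (1 + c ^ 2).im = 2 * c.re * c.im := by simp [pow_two]; ring
  rw [qPar, norm_exp_two_pi_I_div, h, neg_mul]

theorem two_pi_div_pos (k : ℕ) [NeZero k] : 0 < 2 * Real.pi / k :=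
  div_pos Real.two_pi_pos (Nat.cast_pos.2 (NeZero.pos k))

theorem re_sq_add_im_sq {c : ℂ} (hc : ‖c‖ = 1) : c.re ^ 2 + c.im ^ 2 = 1 := by
  have := Complex.sq_norm c
  rw [hc, Complex.normSq_apply] at this
  linarith

theorem norm_qPar_lt_one (k : ℕ) [NeZero k] {c : ℂ} (hr : 0 < c.re) (hi : 0 < c.im) :
    ‖qPar k c‖ < 1 := by
  have := two_pi_div_pos k
  rw [norm_qPar, Real.exp_lt_one_iff]
  have : 0 < 2 * Real.pi / k * (2 * c.re * c.im) := by positivity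
  linarith

theorem sq_add_one_of_norm_eq_one {c : ℂ} (hc : ‖c‖ = 1) : 1 + c ^ 2 = 2 * c * c.re := by
  have := re_sq_add_im_sq hc
  apply Complex.ext
  · simp [pow_two]; linarith
  · simp [pow_two]; ring

/-- In this form the exponent of `q` is that of a real translation by `2 Im c` together with an
integer shift by 2. Multiplication by `q` thus preserves the family of points `dilW`. -/
theorem sq_sub_one_of_norm_eq_one {c : ℂ} (hc : ‖c‖ = 1) :
    1 + c ^ 2 = 2 + 2 * Complex.I * c * c.im := by
  have := re_sq_add_im_sq hc
  apply Complex.ext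
  · simp [pow_two]; linarith
  · simp [pow_two]; ring

theorem dilE_sq (k : ℕ) {c : ℂ} (hc : ‖c‖ = 1) : dilE k c c.re * dilE k c c.re = qPar k c := by
  rw [dilE, qPar, sq_add_one_of_norm_eq_one hc, ← Complex.exp_add]
  congr 1
  ring

theorem dilW_shift (k : ℕ) {c : ℂ} (hc : ‖c‖ = 1) (x : ℝ) (m : ℤ) :
    dilW k c (x - 2 * c.im) (m - 2) = dilW k c x m / qPar k c := by
  rw [dilW, dilW, qPar, sq_sub_one_of_norm_eq_one hc, ← Complex.exp_sub]
  congr 1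
  push_cast
  ring

theorem dilW_add_mul (k : ℕ) [NeZero k] (c : ℂ) (x : ℝ) (m n : ℤ) :
    dilW k c x (m + k * n) = dilW k c x m := by
  have hk : (k : ℂ) ≠ 0 := Nat.cast_ne_zero.2 (NeZero.ne k)
  rw [dilW, dilW, Complex.exp_eq_exp_iff_exists_int]
  refine ⟨n, ?_⟩
  push_cast
  field_simp
  ring

/-- A zero of the denominator forces `a` to be an integer multiple of `Re c = Q/2`, and the only
such multiple strictly inside the strip is `Q/2` itself. -/
theorem eq_re_of_qPoch_eq_zero (k : ℕ) [NeZero k] {c : ℂ} (hc : ‖c‖ = 1) (hr : 0 < c.re)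
    (hi : 0 < c.im) {a : ℝ} (ha : 0 < a) (ha' : a < 2 * c.re) {x : ℝ} {m : ℤ}
    (h : qPoch (dilW k c x m * dilE k c a) (qPar k c) = 0) : a = c.re := by
  obtain ⟨j, hj⟩ := exists_of_qPoch_eq_zero (norm_qPar_lt_one k hr hi) h
  rw [dilW, dilE, qPar, ← Complex.exp_nat_mul, ← Complex.exp_add, ← Complex.exp_add,
    Complex.exp_eq_one_iff] at hj
  obtain ⟨n, hn⟩ := hj
  have hk : (k : ℂ) ≠ 0 := Nat.cast_ne_zero.2 (NeZero.ne k)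
  have hpi : (2 * Real.pi * Complex.I : ℂ) ≠ 0 := Complex.two_pi_I_ne_zero
  have h1 : Complex.I * c * x + m + c * a + j * (1 + c ^ 2) = k * n := by
    have : (2 * Real.pi * Complex.I : ℂ) * (Complex.I * c * x + m + c * a + j * (1 + c ^ 2)) =
        (2 * Real.pi * Complex.I : ℂ) * (k * n) := by
      field_simp at hn
      linear_combination (2 * Real.pi * Complex.I : ℂ) * hn
    exact mul_left_cancel₀ hpi this
  have hre := congrArg Complex.re h1
  have him := congrArg Complex.im h1
  have hcs := re_sq_add_im_sq hc
  simp [pow_two] at hre him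
  -- This is the real part of `c̄` times `h1`: since `c c̄ = 1`, the term in `x` becomes purely
  -- imaginary and `1 + c²` becomes `2 Re c`.
  have key : a = c.re * ((k * n - m - 2 * j : ℤ) : ℝ) := by
    push_cast
    linear_combination c.re * hre + c.im * him - (a + j * c.re) * hcs
  set N := (k * n - m - 2 * j : ℤ)
  have h0 : 0 < N := by
    have : (0 : ℝ) < N := by
      rw [key] at ha
      exact pos_of_mul_pos_right ha hr.le
    exact_mod_cast this
  have h2 : N < 2 := by
    have : (N : ℝ) < 2 := by
      rw [key, mul_comm 2] at ha'
      exact lt_of_mul_lt_mul_left ha' hr.le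
    exact_mod_cast this
  have : N = 1 := by omega
  rw [key, this]; simp

theorem dilNorm_nonneg (k : ℕ) (c : ℂ) (a x : ℝ) (m : ℤ) : 0 ≤ dilNorm k c a x m := by
  unfold dilNorm; positivity

/-- On the middle line `a = Q/2`, `dilE` is a square root of `q`, so numerator and denominator
coincide. The quotient is 1, or 0 by convention where both vanish; this is the one line on which the
denominator may have zeros. -/
theorem dilNorm_le_one (k : ℕ) {c : ℂ} (hc : ‖c‖ = 1) (x : ℝ) (m : ℤ) :
    dilNorm k c c.re x m ≤ 1 := by
  have : qPar k c * (dilW k c x m / dilE k c c.re) = dilW k c x m * dilE k c c.re := by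
    have h0 : dilE k c c.re ≠ 0 := Complex.exp_ne_zero _
    rw [← dilE_sq k hc]
    field_simp
  rw [dilNorm, this]
  exact div_self_le_one _

theorem dilNorm_emod (k : ℕ) [NeZero k] (c : ℂ) (a x : ℝ) (m : ℤ) :
    dilNorm k c a x m = dilNorm k c a x (m % k) := by
  have h : dilW k c x m = dilW k c x (m % k) := by
    conv_lhs => rw [← Int.emod_add_mul_ediv m k]
    exact dilW_add_mul k c x _ _
  simp only [dilNorm, h]

theorem continuous_dilW (k : ℕ) (c : ℂ) (m : ℤ) : Continuous fun x => dilW k c x m := by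
  unfold dilW; fun_prop

theorem tendsto_dilW (k : ℕ) [NeZero k] {c : ℂ} (hr : 0 < c.re) (m : ℤ) :
    Tendsto (fun x => dilW k c x m) atTop (𝓝 0) := by
  rw [tendsto_zero_iff_norm_tendsto_zero]
  simp only [norm_dilW]
  refine Real.tendsto_exp_neg_atTop_nhds_zero.comp (tendsto_id.const_mul_atTop ?_)
  have := two_pi_div_pos k
  positivity

/-- Off the middle line there are no poles, and `dilW → 0` makes the quotient tend to 1 at `+∞`.
Continuity covers the remaining compact interval, and only the `k` residues of `m` matter. -/
theorem exists_dilNorm_le_of_le (k : ℕ) [NeZero k] {c : ℂ} (hc : ‖c‖ = 1) (hr : 0 < c.re)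
    (hi : 0 < c.im) {a : ℝ} (ha : 0 < a) (ha' : a < 2 * c.re) (hne : a ≠ c.re) (R : ℝ) :
    ∃ M, ∀ m, ∀ x, R ≤ x → dilNorm k c a x m ≤ M := by
  have hq := norm_qPar_lt_one k hr hi
  have hone : ∀ m : ℤ, ∃ M, ∀ x, R ≤ x → dilNorm k c a x m ≤ M := by
    intro m
    have hD : ∀ x, qPoch (dilW k c x m * dilE k c a) (qPar k c) ≠ 0 := fun x h =>
      hne (eq_re_of_qPoch_eq_zero k hc hr hi ha ha' h)
    have hw := continuous_dilW k c m
    have hcont : Continuous fun x => dilNorm k c a x m := by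
      unfold dilNorm
      refine Continuous.div ?_ ?_ fun x => norm_ne_zero_iff.2 (hD x)
      · exact ((continuous_qPoch hq).comp
          (continuous_const.mul (hw.div_const _))).norm
      · exact ((continuous_qPoch hq).comp (hw.mul continuous_const)).norm
    have hlim : Tendsto (fun x => dilNorm k c a x m) atTop (𝓝 1) := by
      have h0 := tendsto_dilW k hr m
      have h1 : Tendsto (fun x => ‖qPoch (qPar k c * (dilW k c x m / dilE k c a)) (qPar k c)‖)
          atTop (𝓝 1) := by
        have h2 := ((continuous_qPoch hq).tendsto 0).comp
          (by simpa using (h0.div_const (dilE k c a)).const_mul (qPar k c) :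
            Tendsto (fun x => qPar k c * (dilW k c x m / dilE k c a)) atTop (𝓝 0))
        simpa [qPoch_zero] using h2.norm
      have h3 : Tendsto (fun x => ‖qPoch (dilW k c x m * dilE k c a) (qPar k c)‖)
          atTop (𝓝 1) := by
        have h2 := ((continuous_qPoch hq).tendsto 0).comp
          (by simpa using h0.mul_const (dilE k c a) :
            Tendsto (fun x => dilW k c x m * dilE k c a) atTop (𝓝 0))
        simpa [qPoch_zero] using h2.norm
      have := h1.div h3 one_ne_zero
      rwa [div_one] at this
    obtain ⟨T, hT⟩ := eventually_atTop.1 (hlim.eventually (eventually_le_nhds one_lt_two))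
    obtain ⟨M, hM⟩ := (isCompact_Icc (a := R) (b := T)).bddAbove_image hcont.continuousOn
    refine ⟨max M 2, fun x hx => ?_⟩
    rcases le_total x T with h | h
    · exact le_max_of_le_left (hM ⟨x, ⟨hx, h⟩, rfl⟩)
    · exact le_max_of_le_right (hT x h)
  choose M hM using hone
  obtain ⟨B, hB⟩ := ((Finset.range k).image fun i : ℕ => M i).bddAbove
  refine ⟨B, fun m x hx => ?_⟩
  have hk : (0 : ℤ) < k := by exact_mod_cast NeZero.pos k
  have h1 := Int.emod_nonneg m hk.ne'
  have h2 := Int.emod_lt_of_pos m hk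
  rw [dilNorm_emod]
  refine (hM _ x hx).trans (hB ?_)
  simp only [Finset.coe_image, Set.mem_image, Finset.mem_coe, Finset.mem_range]
  exact ⟨(m % k).toNat, by omega, by rw [Int.toNat_of_nonneg h1]⟩

/-- The shift divides `dilW` by `q`, so `(x; q)_∞ = (1 - x)(qx; q)_∞` exposes one extra factor in
the numerator and one in the denominator. -/
theorem dilNorm_shift (k : ℕ) [NeZero k] {c : ℂ} (hc : ‖c‖ = 1) (hr : 0 < c.re)
    (hi : 0 < c.im) (a x : ℝ) (m : ℤ) :
    dilNorm k c a (x - 2 * c.im) (m - 2) = dilNorm k c a x m *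
      (‖1 - dilW k c x m / dilE k c a‖ / ‖1 - dilW k c x m * dilE k c a / qPar k c‖) := by
  have hq := norm_qPar_lt_one k hr hi
  have h0 : qPar k c ≠ 0 := Complex.exp_ne_zero _
  rw [dilNorm, dilW_shift k hc]
  have e1 : qPar k c * (dilW k c x m / qPar k c / dilE k c a) = dilW k c x m / dilE k c a := by
    field_simp
  have e2 : dilW k c x m / qPar k c * dilE k c a = dilW k c x m * dilE k c a / qPar k c := by ring
  have e3 : qPar k c * (dilW k c x m * dilE k c a / qPar k c) = dilW k c x m * dilE k c a := by
    field_simp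
  rw [e1, e2, qPoch_succ hq (dilW k c x m / dilE k c a),
    qPoch_succ hq (dilW k c x m * dilE k c a / qPar k c), e3, norm_mul, norm_mul, dilNorm]
  rw [mul_comm ‖1 - dilW k c x m / dilE k c a‖, mul_comm ‖1 - _ / qPar k c‖, mul_div_mul_comm]

/-- For large `w` the ratio is asymptotic to that of the leading terms, of modulus `‖q‖ / ‖e‖²`. The
relative error is `O(1/‖w‖)`, put in exponential form for use in `le_exp_of_shift_le`. -/
theorem norm_one_sub_div_le {w e q : ℂ} (hw : w ≠ 0) (he : e ≠ 0) (hq : q ≠ 0)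
    (h : 2 * ‖q‖ / ‖e‖ ≤ ‖w‖) :
    ‖1 - w / e‖ / ‖1 - w * e / q‖ ≤
      ‖q‖ / ‖e‖ ^ 2 * Real.exp ((‖e‖ + 2 * ‖q‖ / ‖e‖) * ‖w‖⁻¹) := by
  have hw' := norm_pos_iff.2 hw
  have he' := norm_pos_iff.2 he
  have hq' := norm_pos_iff.2 hq
  set W := ‖w‖
  set E := ‖e‖
  set r := ‖q‖
  have h1 : ‖1 - w / e‖ ≤ 1 + W / E := by
    simpa using norm_sub_le (1 : ℂ) (w / e)
  have h2 : W * E / r - 1 ≤ ‖1 - w * e / q‖ := by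
    have := norm_sub_norm_le (w * e / q) 1
    rw [norm_sub_rev] at this
    simpa using this
  set t := r / (W * E) with ht
  have ht0 : 0 < t := by positivity
  have ht2 : t ≤ 1 / 2 := by
    rw [ht, div_le_div_iff₀ (by positivity) two_pos]
    rw [div_le_iff₀ he'] at h
    linarith
  have e1 : 1 + W / E = W / E * (1 + E * W⁻¹) := by field_simp; ring
  have e2 : W * E / r - 1 = W * E / r * (1 - t) := by rw [ht]; field_simp
  have h3 : 0 < W * E / r * (1 - t) := by
    have : 0 < 1 - t := by linarith
    positivity
  calc ‖1 - w / e‖ / ‖1 - w * e / q‖ ≤ (1 + W / E) / (W * E / r - 1) := by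
        refine div_le_div₀ (by positivity) h1 (by rw [e2]; exact h3) h2
    _ = r / E ^ 2 * ((1 + E * W⁻¹) * (1 / (1 - t))) := by
        rw [e1, e2]
        have : 1 - t ≠ 0 := by linarith
        field_simp
    _ ≤ r / E ^ 2 * (Real.exp (E * W⁻¹) * Real.exp (2 * t)) := by
        have h4 : 1 + E * W⁻¹ ≤ Real.exp (E * W⁻¹) := by
          linarith [Real.add_one_le_exp (E * W⁻¹)]
        -- For `0 ≤ t ≤ 1/2` one has `1/(1 - t) ≤ 1 + 2t`.
        have h5 : 1 / (1 - t) ≤ Real.exp (2 * t) := by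
          refine le_trans ?_ (Real.add_one_le_exp (2 * t))
          rw [div_le_iff₀ (by linarith)]
          nlinarith
        have : 0 ≤ 1 / (1 - t) := div_nonneg zero_le_one (by linarith)
        gcongr
    _ = _ := by
        rw [← Real.exp_add, ht]
        congr 2
        field_simp

/-- To the left, the shift relation propagates a base bound; its leading factor `‖q‖ / ‖e‖²` equals
`exp(-(l s))` with `s = 2 Im c` and `l = (2π/k)(Re c - a)`. To the right, the modulus is bounded. -/
theorem exists_dilNorm_le (k : ℕ) [NeZero k] {c : ℂ} (hc : ‖c‖ = 1) (hr : 0 < c.re)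
    (hi : 0 < c.im) {a : ℝ} (ha : 0 < a) (ha' : a < 2 * c.re) :
    ∃ C, ∀ m x, dilNorm k c a x m ≤
      C * Real.exp (2 * Real.pi / k * ((c.re - a) * min x 0)) := by
  by_cases hne : a = c.re
  · refine ⟨1, fun m x => ?_⟩
    rw [hne]
    simpa using dilNorm_le_one k hc x m
  have hp := two_pi_div_pos k
  set p := 2 * Real.pi / k
  set E := ‖dilE k c a‖ with hE
  set r := ‖qPar k c‖ with hrr
  have hE0 : 0 < E := norm_pos_iff.2 (Complex.exp_ne_zero _)
  have hr0 : 0 < r := norm_pos_iff.2 (Complex.exp_ne_zero _)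
  obtain ⟨R, hR0, hR⟩ : ∃ R, 0 ≤ R ∧ ∀ x ≤ -R, ∀ m, 2 * r / E ≤ ‖dilW k c x m‖ := by
    -- `exp y ≥ y` turns a linear lower bound on `-x` into the required lower bound on `‖w‖`.
    refine ⟨(2 * r / E) / (p * c.re), by positivity, fun x hx m => ?_⟩
    rw [norm_dilW]
    have : 2 * r / E ≤ p * c.re * (-x) := by
      rw [← div_le_iff₀' (by positivity)]
      linarith
    linarith [Real.add_one_le_exp (-(p * c.re * x))]
  obtain ⟨M, hM⟩ := exists_dilNorm_le_of_le k hc hr hi ha ha' hne (-R - 2 * c.im)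
  obtain ⟨C, hC⟩ := le_exp_of_shift_le (F := dilNorm k c a) (s := 2 * c.im)
    (l := p * (c.re - a)) (K := E + 2 * r / E) (g := p * c.re) (M := M) (R := R)
    (by positivity) (by positivity) (by positivity) hR0 (dilNorm_nonneg k c a)
    (fun m x h1 _ => hM m x h1) (fun m x hx => by
      rw [dilNorm_shift k hc hr hi, mul_assoc]
      refine mul_le_mul_of_nonneg_left ?_ (dilNorm_nonneg _ _ _ _ _)
      refine (norm_one_sub_div_le (w := dilW k c x m) (e := dilE k c a) (q := qPar k c)
        (Complex.exp_ne_zero _) (Complex.exp_ne_zero _) (Complex.exp_ne_zero _)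
        (hR x hx m)).trans_eq ?_
      congr 1
      · rw [norm_qPar, norm_dilE, ← Real.exp_nat_mul, ← Real.exp_sub]
        congr 1
        push_cast
        ring
      · rw [norm_dilW, ← Real.exp_neg, neg_neg])
  refine ⟨max C (M * Real.exp (p * (|c.re - a| * R))), fun m x => ?_⟩
  have hM0 : 0 ≤ M := (dilNorm_nonneg k c a 0 0).trans (hM 0 0 (by linarith))
  rcases le_total x (-R) with h | h
  · refine (hC m x h).trans ?_
    rw [min_eq_left (by linarith), ← mul_assoc p (c.re - a) x]
    exact mul_le_mul_of_nonneg_right (le_max_left _ _) (Real.exp_pos _).le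
  · refine (hM m x (by linarith)).trans ?_
    have h1 : M ≤ M * Real.exp (p * (|c.re - a| * R)) *
        Real.exp (p * ((c.re - a) * min x 0)) := by
      rw [mul_assoc, ← Real.exp_add]
      refine le_mul_of_one_le_right hM0 (Real.one_le_exp ?_)
      rw [← mul_add]
      refine mul_nonneg hp.le ?_
      have h2 : |min x 0| ≤ R := by
        rw [abs_le]
        exact ⟨le_min h (by linarith), (min_le_right _ _).trans hR0⟩
      have h3 : -(|c.re - a| * R) ≤ (c.re - a) * min x 0 := by
        refine le_trans ?_ (neg_abs_le _)
        rw [abs_mul]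
        gcongr
      linarith
    exact h1.trans (mul_le_mul_of_nonneg_right (le_max_right _ _) (Real.exp_pos _).le)

/-! ### The decay of the octahedron partition function -/

theorem norm_inv_of_norm_eq_one {b : ℂ} (hb : ‖b‖ = 1) : ‖b⁻¹‖ = 1 := by simp [hb]

theorem inv_eq_conj_of_norm_eq_one {b : ℂ} (hb : ‖b‖ = 1) : b⁻¹ = (starRingEnd ℂ) b :=
  Complex.inv_eq_conj hb

theorem Qb_eq {b : ℂ} (hb : ‖b‖ = 1) : Qb b = 2 * b.re := by
  rw [Qb, inv_eq_conj_of_norm_eq_one hb]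
  simp
  ring

theorem qTil_eq (k : ℕ) (b : ℂ) : qTil k b = qPar k b⁻¹ := rfl

/-- For `‖b‖ = 1` inversion is conjugation. The product over `q̃⁻¹` is therefore the conjugate of
one over `q`, and moduli involve a single nome. -/
theorem inv_qPar_inv (k : ℕ) {b : ℂ} (hb : ‖b‖ = 1) :
    (qPar k b⁻¹)⁻¹ = (starRingEnd ℂ) (qPar k b) := by
  rw [qPar, qPar, ← Complex.exp_neg, ← Complex.exp_conj, inv_eq_conj_of_norm_eq_one hb]
  congr 1
  simp only [map_mul, map_div₀, map_add, map_one, map_pow, map_natCast, map_ofNat, Complex.conj_I,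
    Complex.conj_ofReal]
  ring

theorem norm_qPoch_div {k : ℕ} [NeZero k] {c : ℂ} (hc : ‖c‖ = 1) (hr : 0 < c.re) (hi : 0 < c.im)
    {u v : ℂ} {a x : ℝ} {m : ℤ} (hu : u = dilW k c x m / dilE k c a)
    (hv : v = (starRingEnd ℂ) (dilW k c x m * dilE k c a)) :
    ‖qPoch (qPar k c * u) (qPar k c) / qPoch v (qPar k c⁻¹)⁻¹‖ = dilNorm k c a x m := by
  rw [norm_div, hu, hv, inv_qPar_inv k hc, qPoch_conj (norm_qPar_lt_one k hr hi), Complex.norm_conj,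
    dilNorm]

theorem norm_qDilog_of_im_pos (k : ℕ) [NeZero k] {b : ℂ} (hb : ‖b‖ = 1) (hr : 0 < b.re)
    (hi : 0 < b.im) (x a : ℝ) (m : ZMod k) :
    ‖qDilog k b ((x : ℂ) + a * Complex.I) m‖ = dilNorm k b a x m.val := by
  rw [qDilog, if_pos (norm_qPar_lt_one k hr hi), qTil_eq]
  apply norm_qPoch_div hb hr hi
  · rw [zPar, dilW, dilE, ← Complex.exp_neg, ← Complex.exp_sub]
    congr 1
    push_cast
    linear_combination ((2 * Real.pi * Complex.I / k) * b * a) * Complex.I_sq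
  · rw [zTil, dilW, dilE, ← Complex.exp_neg, ← Complex.exp_add, ← Complex.exp_conj,
      inv_eq_conj_of_norm_eq_one hb]
    congr 1
    simp only [map_mul, map_div₀, map_add, map_natCast, map_ofNat, map_intCast, Complex.conj_I,
      Complex.conj_ofReal]
    push_cast
    linear_combination ((2 * Real.pi * Complex.I / k) * (starRingEnd ℂ) b * a) * Complex.I_sq

/-- The definition in the regime `|q| > 1` is the other one with `b` replaced by `b⁻¹` and `m` by
`-m`, so both signs of `Im b` reduce to `dilNorm`. -/
theorem norm_qDilog_of_im_neg (k : ℕ) [NeZero k] {b : ℂ} (hb : ‖b‖ = 1) (hr : 0 < b⁻¹.re)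
    (hi : 0 < b⁻¹.im) (x a : ℝ) (m : ZMod k) :
    ‖qDilog k b ((x : ℂ) + a * Complex.I) m‖ = dilNorm k b⁻¹ a x (-m.val) := by
  have hb' := norm_inv_of_norm_eq_one hb
  have h1 : ¬ ‖qPar k b‖ < 1 := by
    have h := inv_qPar_inv k hb'
    rw [inv_inv] at h
    have h2 := congrArg norm h
    rw [norm_inv, Complex.norm_conj] at h2
    have h3 := norm_qPar_lt_one k hr hi
    have h0 : 0 < ‖qPar k b‖ := norm_pos_iff.2 (Complex.exp_ne_zero _)
    rw [← h2, inv_lt_one₀ h0] at h3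
    exact h3.le.not_gt
  rw [qDilog, if_neg h1, qTil_eq]
  conv_lhs => rw [show (qPar k b)⁻¹ = (qPar k b⁻¹⁻¹)⁻¹ by rw [inv_inv]]
  apply norm_qPoch_div hb' hr hi
  · rw [zTil, dilW, dilE, ← Complex.exp_neg, ← Complex.exp_sub]
    congr 1
    push_cast
    linear_combination ((2 * Real.pi * Complex.I / k) * b⁻¹ * a) * Complex.I_sq
  · rw [zPar, dilW, dilE, ← Complex.exp_neg, ← Complex.exp_add, ← Complex.exp_conj,
      inv_eq_conj_of_norm_eq_one hb]
    congr 1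
    simp only [map_mul, map_div₀, map_add, map_natCast, map_ofNat, map_intCast, Complex.conj_I,
      Complex.conj_ofReal, Complex.conj_conj]
    push_cast
    linear_combination ((2 * Real.pi * Complex.I / k) * b * a) * Complex.I_sq

theorem inv_re_im_of_norm_eq_one {b : ℂ} (hb : ‖b‖ = 1) :
    b⁻¹.re = b.re ∧ b⁻¹.im = -b.im := by
  rw [inv_eq_conj_of_norm_eq_one hb]
  simp

theorem exists_norm_qDilog_le (k : ℕ) [NeZero k] {b : ℂ} (hb : ‖b‖ = 1) (hr : 0 < b.re)
    (hi : b.im ≠ 0) {a : ℝ} (ha : 0 < a) (ha' : a < Qb b) :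
    ∃ C, 0 ≤ C ∧ ∀ m (x : ℝ), ‖qDilog k b (x + a * Complex.I) m‖ ≤
      C * Real.exp (2 * Real.pi / k * ((Qb b / 2 - a) * min x 0)) := by
  have hI := inv_re_im_of_norm_eq_one hb
  rw [Qb_eq hb] at ha' ⊢
  rw [mul_div_cancel_left₀ _ two_ne_zero]
  rcases lt_or_gt_of_ne hi with h | h
  · obtain ⟨C, hC⟩ := exists_dilNorm_le k (norm_inv_of_norm_eq_one hb) (by rw [hI.1]; exact hr)
      (by rw [hI.2]; linarith) ha (by rw [hI.1]; exact ha')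
    rw [hI.1] at hC
    refine ⟨C, ?_, fun m x => ?_⟩
    · simpa using (dilNorm_nonneg _ _ _ _ _).trans (hC 0 0)
    · rw [norm_qDilog_of_im_neg k hb (by rw [hI.1]; exact hr) (by rw [hI.2]; linarith)]
      exact hC _ _
  · obtain ⟨C, hC⟩ := exists_dilNorm_le k hb hr h ha ha'
    refine ⟨C, ?_, fun m x => ?_⟩
    · simpa using (dilNorm_nonneg _ _ _ _ _).trans (hC 0 0)
    · rw [norm_qDilog_of_im_pos k hb hr h]
      exact hC _ _

/-- Continuity is not available because of poles, but a quotient of continuous functions is Borel.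
-/
theorem measurable_qDilog (k : ℕ) [NeZero k] {b : ℂ} (hb : ‖b‖ = 1) (hr : 0 < b.re)
    (hi : b.im ≠ 0) (m : ZMod k) : Measurable fun μ => qDilog k b μ m := by
  have hI := inv_re_im_of_norm_eq_one hb
  have key : ∀ {q : ℂ}, ‖q‖ < 1 → ∀ {f : ℂ → ℂ}, Continuous f →
      Measurable fun μ => qPoch (f μ) q := fun hq _ hf =>
    ((continuous_qPoch hq).comp hf).measurable
  have hz : Continuous fun μ => (zPar k b μ m)⁻¹ := by
    simp only [zPar, ← Complex.exp_neg]; fun_prop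
  have hz' : Continuous fun μ => (zTil k b μ m)⁻¹ := by
    simp only [zTil, ← Complex.exp_neg]; fun_prop
  have hinv : ∀ {c : ℂ}, ‖c‖ = 1 → ‖(qPar k c⁻¹)⁻¹‖ = ‖qPar k c‖ := fun hc => by
    rw [inv_qPar_inv k hc, Complex.norm_conj]
  unfold qDilog
  split_ifs with h
  · exact (key h (continuous_const.mul hz)).div
      (key (by rw [qTil_eq, hinv hb]; exact h) hz')
  · have him : b.im < 0 := by
      rcases lt_or_gt_of_ne hi with h' | h'
      · exact h'
      · exact absurd (norm_qPar_lt_one k hr h') h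
    have h2 : ‖qPar k b⁻¹‖ < 1 :=
      norm_qPar_lt_one k (by rw [hI.1]; exact hr) (by rw [hI.2]; linarith)
    have h3 := hinv (norm_inv_of_norm_eq_one hb)
    rw [inv_inv] at h3
    exact (key h2 (continuous_const.mul hz')).div (key (by rw [h3]; exact h2) hz)

theorem exists_pos_forall_le {ι : Type*} [Finite ι] {f : ι → ℝ} (hf : ∀ i, 0 < f i) :
    ∃ ε, 0 < ε ∧ ∀ i, ε ≤ f i := by
  cases isEmpty_or_nonempty ι
  · exact ⟨1, one_pos, fun i => isEmptyElim i⟩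
  · obtain ⟨i, hi⟩ := Finite.exists_min f
    exact ⟨f i, hf i, hi⟩

/-- A lower bound for a piecewise linear function on `ℝ³`, from its values on the rays generated by
`eᵢ`, `-eᵢ` and `eᵢ - eⱼ`. -/
theorem le_of_le_on_rays {A B : Fin 3 → ℝ} {s ε : ℝ} (hε : 0 < ε) (hA : ∀ i, ε ≤ A i)
    (hB : ∀ i, ε ≤ B i + s) (hAB : ∀ i j, i ≠ j → ε ≤ B i + A j) (x : Fin 3 → ℝ) :
    ε / 2 * ∑ i, |x i| ≤
      ∑ i, B i * x i - ∑ i, (A i + B i) * min (x i) 0 - s * min (-∑ i, x i) 0 := by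
  have hp : ∀ t : ℝ, 0 ≤ max t 0 := fun t => le_max_right _ _
  have hn : ∀ t : ℝ, 0 ≤ -min t 0 := fun t => by simp
  have hx : ∀ t : ℝ, max t 0 - -min t 0 = t := fun t => by
    rcases le_total t 0 with h | h <;> simp [h]
  have habs : ∀ t : ℝ, |t| = max t 0 + -min t 0 := fun t => by
    rcases le_total t 0 with h | h <;> simp [h, abs_of_nonneg, abs_of_nonpos]
  have hpn : ∀ t : ℝ, max t 0 * -min t 0 = 0 := fun t => by
    rcases le_total t 0 with h | h <;> simp [h]
  obtain ⟨p, hpdef⟩ : ∃ p : Fin 3 → ℝ, ∀ i, p i = max (x i) 0 := ⟨_, fun _ => rfl⟩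
  obtain ⟨n, hndef⟩ : ∃ n : Fin 3 → ℝ, ∀ i, n i = -min (x i) 0 := ⟨_, fun _ => rfl⟩
  have hxi : ∀ i, x i = p i - n i := fun i => by rw [hpdef, hndef, hx]
  have hmi : ∀ i, min (x i) 0 = -n i := fun i => by rw [hndef, neg_neg]
  have hai : ∀ i, |x i| = p i + n i := fun i => by rw [hpdef, hndef, habs]
  have hp0 : ∀ i, 0 ≤ p i := fun i => by rw [hpdef]; exact hp _
  have hn0 : ∀ i, 0 ≤ n i := fun i => by rw [hndef]; exact hn _
  -- The weights `pᵢ nⱼ` couple positive and negative parts of `x` into the directions `eᵢ - eⱼ`.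
  -- The diagonal needs no hypothesis, since `pᵢ nᵢ = 0`.
  have hD : ∀ i j, 0 ≤ p i * n j * (B i + A j - ε) := by
    intro i j
    by_cases h : i = j
    · have : p i * n j = 0 := by rw [h, hpdef, hndef, hpn]
      rw [this, zero_mul]
    · exact mul_nonneg (mul_nonneg (hp0 i) (hn0 j)) (by linarith [hAB i j h])
  simp only [hmi, hai]
  have hsum : ∑ i, x i = ∑ i, p i - ∑ i, n i := by
    rw [← Finset.sum_sub_distrib]; exact Finset.sum_congr rfl fun i _ => hxi i
  rw [hsum]
  simp only [hxi]
  have hDs : ∑ i, ∑ j, p i * n j * (B i + A j - ε) =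
      (∑ i, p i * B i) * ∑ i, n i + (∑ i, p i) * ∑ j, n j * A j - ε * (∑ i, p i) * ∑ j, n j := by
    simp only [Fin.sum_univ_three]; ring
  have hDs0 : 0 ≤ ∑ i, ∑ j, p i * n j * (B i + A j - ε) :=
    Finset.sum_nonneg fun i _ => Finset.sum_nonneg fun j _ => hD i j
  rw [hDs] at hDs0
  have hBs : 0 ≤ ∑ i, p i * (B i + s - ε) :=
    Finset.sum_nonneg fun i _ => mul_nonneg (hp0 i) (by linarith [hB i])
  have hBs' : ∑ i, p i * (B i + s - ε) = ∑ i, p i * B i + (s - ε) * ∑ i, p i := by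
    simp only [Fin.sum_univ_three]; ring
  have hAs : 0 ≤ ∑ i, n i * (A i - ε) :=
    Finset.sum_nonneg fun i _ => mul_nonneg (hn0 i) (by linarith [hA i])
  have hAs' : ∑ i, n i * (A i - ε) = ∑ i, n i * A i - ε * ∑ i, n i := by
    simp only [Fin.sum_univ_three]; ring
  have e1 : ∑ i, B i * (p i - n i) - ∑ i, (A i + B i) * -n i =
      ∑ i, p i * B i + ∑ i, n i * A i := by
    simp only [Fin.sum_univ_three]; ring
  rw [e1, Finset.sum_add_distrib]
  rw [hBs'] at hBs
  rw [hAs'] at hAs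
  have hP0 : 0 ≤ ∑ i, p i := Finset.sum_nonneg fun i _ => hp0 i
  have hN0 : 0 ≤ ∑ i, n i := Finset.sum_nonneg fun i _ => hn0 i
  generalize ∑ i, p i * B i = PB at *
  generalize ∑ i, n i * A i = NA at *
  generalize ∑ i, p i = P at *
  generalize ∑ i, n i = N at *
  rcases le_total N P with h | h
  · rw [min_eq_left (by linarith)]
    rcases hP0.eq_or_lt with h0 | h0
    · have hN : N = 0 := by linarith
      subst h0; subst hN
      linarith
    · have h1 : P * (ε * P) ≤ P * (PB + NA - s * -(P - N)) := by
        nlinarith [mul_nonneg hBs (sub_nonneg.2 h)]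
      have h2 := le_of_mul_le_mul_left h1 h0
      nlinarith
  · rw [min_eq_right (by linarith)]
    rcases hN0.eq_or_lt with h0 | h0
    · have hP : P = 0 := by linarith
      subst h0; subst hP
      linarith
    · have h1 : N * (ε * N) ≤ N * (PB + NA - s * 0) := by
        nlinarith [mul_nonneg hAs (sub_nonneg.2 h)]
      have h2 := le_of_mul_le_mul_left h1 h0
      nlinarith

/-- The conditions `αᵢ > 0` and `∑ α < Q` keep all four dilogarithms in their strips; the other
three families are the values of the total exponent on the rays of `le_of_le_on_rays`. -/
theorem exists_exp_mul_norm_Zoct_le (k : ℕ) [NeZero k] {b : ℂ} (hb : ‖b‖ = 1) (hr : 0 < b.re)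
    (hi : b.im ≠ 0) {α β : Fin 3 → ℝ} (h : OctAngle (Qb b) α β) :
    ∃ C δ, 0 ≤ C ∧ 0 < δ ∧ ∀ (x : Fin 3 → ℝ) (m : Fin 3 → ZMod k),
      Real.exp (-(2 * Real.pi / k * ∑ i, β i * x i)) *
        ‖Zoct k b (fun i => x i + α i * Complex.I) m‖ ≤ C * Real.exp (-(δ * ∑ i, |x i|)) := by
  obtain ⟨h1, h2, h3, h4, h5⟩ := h
  -- `ε` is a common margin for the three, three and six strict inequalities attached to `-eᵢ`, `eᵢ`
  -- and `eᵢ - eⱼ`.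
  obtain ⟨ε, hε, hle⟩ := exists_pos_forall_le
    (f := fun i : Fin 3 ⊕ Fin 3 ⊕ {p : Fin 3 × Fin 3 // p.1 ≠ p.2} =>
      Sum.elim (fun i => Qb b / 2 - α i - β i) (Sum.elim (fun i => β i + (∑ l, α l - Qb b / 2))
        fun p => β p.1.1 + (Qb b / 2 - α p.1.2 - β p.1.2)) i) (by
      rintro (i | i | ⟨⟨i, j⟩, hij⟩)
      · simpa using by linarith [h3 i]
      · simpa using by linarith [h4 i]
      · simpa using by linarith [h5 i j hij])
  have hray := le_of_le_on_rays (A := fun i => Qb b / 2 - α i - β i) (B := β)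
    (s := ∑ l, α l - Qb b / 2) hε (fun i => hle (.inl i)) (fun i => hle (.inr (.inl i)))
    (fun i j hij => hle (.inr (.inr ⟨(i, j), hij⟩)))
  have hα : ∀ i, α i < Qb b := fun i =>
    (Finset.single_le_sum (fun j _ => (h1 j).le) (Finset.mem_univ i)).trans_lt h2
  have hsum : 0 < ∑ i, α i := Finset.sum_pos (fun i _ => h1 i) Finset.univ_nonempty
  choose C hC0 hC using fun i => exists_norm_qDilog_le k hb hr hi (h1 i) (hα i)
  obtain ⟨D, hD0, hD⟩ := exists_norm_qDilog_le k hb hr hi (a := Qb b - ∑ i, α i)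
    (by linarith) (by linarith)
  have hp := two_pi_div_pos k
  refine ⟨(∏ i, C i) * D, 2 * Real.pi / k * (ε / 2), mul_nonneg
    (Finset.prod_nonneg fun i _ => hC0 i) hD0, by positivity, fun x m => ?_⟩
  have e : Complex.I * (Qb b : ℂ) - ∑ i, ((x i : ℂ) + α i * Complex.I) =
      ((-∑ i, x i : ℝ) : ℂ) + ((Qb b - ∑ i, α i : ℝ) : ℂ) * Complex.I := by
    push_cast
    rw [Finset.sum_add_distrib, ← Finset.sum_mul]
    ring
  rw [Zoct, norm_mul, norm_prod, e]
  calc _ ≤ Real.exp (-(2 * Real.pi / k * ∑ i, β i * x i)) *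
        ((∏ i, (C i * Real.exp (2 * Real.pi / k * ((Qb b / 2 - α i) * min (x i) 0)))) *
          (D * Real.exp (2 * Real.pi / k *
            ((Qb b / 2 - (Qb b - ∑ i, α i)) * min (-∑ i, x i) 0)))) := by
        gcongr with i
        · exact Finset.prod_nonneg fun i _ => mul_nonneg (hC0 i) (Real.exp_pos _).le
        · exact hC i _ _
        · exact hD _ _
    _ = (∏ i, C i) * D * Real.exp (-(2 * Real.pi / k * (∑ i, β i * x i -
          ∑ i, (Qb b / 2 - α i - β i + β i) * min (x i) 0 -
            (∑ l, α l - Qb b / 2) * min (-∑ i, x i) 0))) := by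
        rw [Finset.prod_mul_distrib, ← Real.exp_sum, ← Finset.mul_sum]
        have : ∀ u v w : ℝ, Real.exp u * (∏ i, C i) * Real.exp v * D * Real.exp w =
            (∏ i, C i) * D * Real.exp (u + v + w) := fun u v w => by
          rw [Real.exp_add, Real.exp_add]; ring
        rw [← mul_assoc, ← mul_assoc, ← mul_assoc, this]
        congr 2
        simp only [sub_add_cancel]
        ring
    _ ≤ _ := by
        refine mul_le_mul_of_nonneg_left (Real.exp_le_exp.2 (neg_le_neg ?_))
          (mul_nonneg (Finset.prod_nonneg fun i _ => hC0 i) hD0)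
        rw [mul_assoc]
        exact mul_le_mul_of_nonneg_left (hray x) hp.le

/-! ### The state integral -/

/-- This is the condition `A Bᵀ = B Aᵀ` on the upper blocks of a symplectic matrix. -/
theorem matS_transpose : matS.transpose = matS := by decide +kernel

/-- Twice the inverse of `matB`. -/
def matBInv : Matrix (Fin 15) (Fin 15) ℤ :=
  !![0, 0, 0, 0, 0, 0, 0, 0, 0, 0, 0, -2, 0, 0, 0;
    -1, 0, 0, 0, -1, -1, -1, 0, 0, 0, 0, 0, 0, 0, 0;
    0, -1, 0, 0, -1, 0, 0, -1, -1, 0, 0, 0, 0, 0, 0;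
    -1, 1, 0, 1, 0, -1, 0, 1, 0, -1, 0, 0, 0, 0, 0;
    -1, 1, 1, 1, 0, 0, 0, 0, 0, 0, 0, 0, 0, 0, 0;
    -1, 1, 1, 1, 0, 0, 0, 0, 0, 0, -2, 0, 0, 0, 0;
    1, -1, 0, 0, 0, -1, 1, -1, -1, 0, 0, 0, 0, -2, 0;
    1, -1, 0, 0, 0, -1, -1, -1, -1, 0, 0, 0, 0, -2, -2;
    0, 0, 1, 0, 0, -1, 0, -1, 0, -1, -2, 0, 0, -2, 0;
    1, 0, 0, 0, 1, 1, 1, 0, 0, 0, 0, -2, 0, 0, 2;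
    1, 0, 0, 0, -1, 1, 1, 0, 0, 0, 0, 0, -2, 0, 2;
    0, 0, 0, 1, 0, 0, 1, 0, 1, -1, 0, 0, 0, 0, 2;
    0, 0, 0, 0, 0, 0, 0, 0, 0, 0, 0, 0, 2, 0, 0;
    0, 1, 0, 0, 1, 0, 0, 1, 1, 0, 0, 0, 2, 2, 0;
    0, 1, -1, 0, 1, -1, 0, 0, 1, -1, 0, 0, 2, 0, 0]

theorem matB_mul_matBInv : matB * matBInv = 2 := by decide +kernel

theorem isUnit_det_matB : IsUnit (matB.map (Int.cast : ℤ → ℝ)).det := by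
  have h : (matB.map (Int.cast : ℤ → ℝ)) * (matBInv.map (Int.cast : ℤ → ℝ)) = 2 := by
    have := congrArg (fun M => M.map (Int.castRingHom ℝ)) matB_mul_matBInv
    simp only [Matrix.map_mul] at this
    refine this.trans ?_
    ext i j
    simp [Matrix.ofNat_apply, apply_ite]
  have h2 := congrArg Matrix.det h
  rw [Matrix.det_mul] at h2
  refine isUnit_iff_ne_zero.2 fun h0 => ?_
  rw [h0, zero_mul, show (2 : Matrix (Fin 15) (Fin 15) ℝ) = (2 : ℝ) • 1 by
    ext i j; simp [Matrix.ofNat_apply, Matrix.one_apply], Matrix.det_smul] at h2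
  norm_num at h2

theorem sum_octIdx {M : Type*} [AddCommMonoid M] (f : Fin 15 → M) :
    ∑ I, f I = ∑ a, ∑ i, f (octIdx a i) := by
  rw [← (finProdFinEquiv (m := 5) (n := 3)).sum_comp f, Fintype.sum_prod_type]
  refine Finset.sum_congr rfl fun a _ => Finset.sum_congr rfl fun i _ => congrArg f ?_
  ext
  simp [octIdx, finProdFinEquiv]
  ring

theorem exists_exp_mul_norm_Zprod_le (k : ℕ) [NeZero k] {b : ℂ} (hb : ‖b‖ = 1) (hr : 0 < b.re)
    (hi : b.im ≠ 0) {α β : Fin 15 → ℝ}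
    (h : ∀ a, OctAngle (Qb b) (fun i => α (octIdx a i)) fun i => β (octIdx a i)) :
    ∃ C δ, 0 ≤ C ∧ 0 < δ ∧ ∀ (x : Fin 15 → ℝ) (m : Fin 15 → ZMod k),
      Real.exp (-(2 * Real.pi / k * ∑ I, β I * x I)) *
        ‖Zprod k b (fun I => x I + α I * Complex.I) m‖ ≤ C * Real.exp (-(δ * ∑ I, |x I|)) := by
  choose C δ hC hδ hle using fun a => exists_exp_mul_norm_Zoct_le k hb hr hi (h a)
  obtain ⟨ε, hε, hεδ⟩ := exists_pos_forall_le hδ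
  refine ⟨∏ a, C a, ε, Finset.prod_nonneg fun a _ => hC a, hε, fun x m => ?_⟩
  rw [Zprod, norm_prod, sum_octIdx, sum_octIdx, Finset.mul_sum, Finset.mul_sum,
    ← Finset.sum_neg_distrib, ← Finset.sum_neg_distrib, Real.exp_sum, Real.exp_sum,
    ← Finset.prod_mul_distrib, ← Finset.prod_mul_distrib]
  refine Finset.prod_le_prod (fun a _ => by positivity) fun a _ => ?_
  refine (hle a (fun i => x (octIdx a i)) fun i => m (octIdx a i)).trans ?_
  gcongr
  · exact hC a
  · exact hεδ a

theorem measurable_Zprod (k : ℕ) [NeZero k] {b : ℂ} (hb : ‖b‖ = 1) (hr : 0 < b.re)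
    (hi : b.im ≠ 0) (m : Fin 15 → ZMod k) : Measurable fun μ => Zprod k b μ m := by
  unfold Zprod Zoct
  refine Finset.measurable_prod _ fun a _ => ?_
  refine (Finset.measurable_prod _ fun i _ => ?_).mul ?_
  · exact (measurable_qDilog k hb hr hi _).comp (measurable_pi_apply _)
  · exact (measurable_qDilog k hb hr hi _).comp (by fun_prop)

theorem continuous_mulVec_intCast (M : Matrix (Fin 15) (Fin 15) ℤ) :
    Continuous fun μ : Fin 15 → ℂ => (M.map (Int.cast : ℤ → ℂ)).mulVec μ :=
  continuous_const.matrix_mulVec continuous_id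

theorem measurable_Z2 (k : ℕ) [NeZero k] {b : ℂ} (hb : ‖b‖ = 1) (hr : 0 < b.re)
    (hi : b.im ≠ 0) (m : Fin 15 → ZMod k) : Measurable fun μ => Z2 k b μ m := by
  unfold Z2 Z1
  refine Measurable.mul (Continuous.measurable ?_) (measurable_const.mul
    ((measurable_Zprod k hb hr hi _).comp
      (continuous_const.matrix_mulVec continuous_id).neg.measurable))
  have := continuous_id.dotProduct (continuous_mulVec_intCast matS)
  simp only [id] at this
  fun_prop

theorem measurable_stInt (k : ℕ) [NeZero k] {b : ℂ} (hb : ‖b‖ = 1) (hr : 0 < b.re)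
    (hi : b.im ≠ 0) (β : Fin 15 → ℝ) (m n : Fin 15 → ZMod k) :
    Measurable fun p : (Fin 15 → ℂ) × (Fin 15 → ℝ) => stInt k b β p.1 m n p.2 := by
  unfold stInt
  refine Measurable.mul (Continuous.measurable ?_) ((measurable_Z2 k hb hr hi n).comp
    (Continuous.measurable ?_)) <;> fun_prop

theorem mulVec_map_ofReal (M : Matrix (Fin 15) (Fin 15) ℤ) (ν β : Fin 15 → ℝ) :
    (M.map (Int.cast : ℤ → ℂ)).mulVec (fun I => (ν I : ℂ) + β I * Complex.I) =
      fun I => ((M.map (Int.cast : ℤ → ℝ)).mulVec ν I : ℂ) +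
        ((M.map (Int.cast : ℤ → ℝ)).mulVec β I : ℂ) * Complex.I := by
  ext I
  simp only [Matrix.mulVec, dotProduct, Matrix.map_apply]
  push_cast
  rw [Finset.sum_mul, ← Finset.sum_add_distrib]
  exact Finset.sum_congr rfl fun J _ => by ring

/-- Symmetry of `A Bᵀ` lets the two cross terms of the quadratic form combine; this imaginary part
is all that the Gaussian phase contributes to the modulus. -/
theorem im_dotProduct_mulVec_matS (ν β : Fin 15 → ℝ) :
    (dotProduct (fun I => (ν I : ℂ) + β I * Complex.I) ((matS.map (Int.cast : ℤ → ℂ)).mulVec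
      fun I => (ν I : ℂ) + β I * Complex.I)).im =
      2 * dotProduct ν ((matS.map (Int.cast : ℤ → ℝ)).mulVec β) := by
  have hsymm : dotProduct β ((matS.map (Int.cast : ℤ → ℝ)).mulVec ν) =
      dotProduct ν ((matS.map (Int.cast : ℤ → ℝ)).mulVec β) := by
    rw [Matrix.dotProduct_mulVec, ← Matrix.mulVec_transpose, ← Matrix.transpose_map, matS_transpose,
      dotProduct_comm]
  rw [mulVec_map_ofReal, dotProduct, Complex.im_sum]
  have : ∀ I, (((ν I : ℂ) + β I * Complex.I) *
      (((matS.map (Int.cast : ℤ → ℝ)).mulVec ν I : ℂ) +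
        ((matS.map (Int.cast : ℤ → ℝ)).mulVec β I : ℂ) * Complex.I)).im =
      ν I * (matS.map (Int.cast : ℤ → ℝ)).mulVec β I +
        β I * (matS.map (Int.cast : ℤ → ℝ)).mulVec ν I := fun I => by simp
  rw [Finset.sum_congr rfl fun I _ => this I, Finset.sum_add_distrib]
  simp only [dotProduct] at hsymm ⊢
  rw [hsymm]
  ring

theorem shiftArg_eq (b : ℂ) (μ α : Fin 15 → ℝ) :
    shiftArg b (fun I => (μ I : ℂ) + α I * Complex.I) =
      fun I => (μ I : ℂ) + ((α I - Qb b / 2 * vecT I : ℝ) : ℂ) * Complex.I := by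
  ext I
  simp only [shiftArg]
  push_cast
  ring

/-- All phases drop out. The real part `u` of the external argument enters only through a factor
independent of `ν`, and the exponent is linear in `ν`. -/
theorem norm_stInt (k : ℕ) (b : ℂ) (β u γ : Fin 15 → ℝ) (m n : Fin 15 → ZMod k)
    (ν : Fin 15 → ℝ) :
    ‖stInt k b β (fun I => (u I : ℂ) + γ I * Complex.I) m n ν‖ =
      Real.exp (2 * Real.pi / k * dotProduct u β) *
      (4 * (Real.exp (2 * Real.pi / k * dotProduct ν (γ + (matS.map (Int.cast : ℤ → ℝ)).mulVec β)) *
        ‖Zprod k b (fun I => ((-((matB.map (Int.cast : ℤ → ℝ)).transpose.mulVec ν)) I : ℂ) +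
          ((-((matB.map (Int.cast : ℤ → ℝ)).transpose.mulVec β)) I : ℂ) * Complex.I)
          (-((matB.map (Int.cast : ℤ → ZMod k)).transpose.mulVec n))‖)) := by
  have hB : -((matB.map (Int.cast : ℤ → ℂ)).transpose.mulVec
      fun I => (ν I : ℂ) + β I * Complex.I) =
      fun I => ((-((matB.map (Int.cast : ℤ → ℝ)).transpose.mulVec ν)) I : ℂ) +
          ((-((matB.map (Int.cast : ℤ → ℝ)).transpose.mulVec β)) I : ℂ) * Complex.I := by
    rw [← Matrix.transpose_map, mulVec_map_ofReal]
    ext I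
    simp only [Pi.neg_apply, ← Matrix.transpose_map]
    push_cast
    ring
  rw [stInt, norm_mul, norm_exp_two_pi_I_div, Z2, norm_mul, norm_mul, norm_zpow, norm_neg, norm_one,
    one_zpow, one_mul, Z1, norm_mul, hB, norm_mul, Complex.norm_I, mul_one]
  have e1 : (-∑ I, ((u I : ℂ) + γ I * Complex.I) * ((ν I : ℂ) + β I * Complex.I) +
      ∑ I, ((m I).val : ℂ) * ((n I).val : ℂ)).im = -(dotProduct u β + dotProduct ν γ) := by
    have h1 : (∑ I, ((m I).val : ℂ) * ((n I).val : ℂ)).im = 0 := by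
      rw [Complex.im_sum]
      exact Finset.sum_eq_zero fun I _ => by simp
    rw [Complex.add_im, h1, Complex.neg_im, Complex.im_sum, add_zero]
    simp only [dotProduct]
    rw [← Finset.sum_add_distrib]
    congr 1
    exact Finset.sum_congr rfl fun I _ => by simp; ring
  have e2 : ‖Complex.exp (Complex.I * Real.pi / k *
      (-dotProduct (fun I => (ν I : ℂ) + β I * Complex.I) ((matS.map (Int.cast : ℤ → ℂ)).mulVec
        fun I => (ν I : ℂ) + β I * Complex.I) + (quadZ n : ℂ)))‖ =
      Real.exp (2 * Real.pi / k * dotProduct ν ((matS.map (Int.cast : ℤ → ℝ)).mulVec β)) := by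
    have h0 : ∀ w : ℂ, Complex.I * Real.pi / k * w = 2 * Real.pi * Complex.I / k * (w / 2) :=
      fun w => by ring
    rw [h0, norm_exp_two_pi_I_div]
    have h2 : ∀ w : ℂ, (w / 2).im = w.im / 2 := fun w => by simp
    rw [h2, Complex.add_im, Complex.neg_im, im_dotProduct_mulVec_matS, Complex.intCast_im]
    congr 1
    ring
  rw [e1, e2, dotProduct_add, mul_add (2 * Real.pi / k), Real.exp_add]
  rw [neg_mul_neg, mul_add, Real.exp_add]
  simp only [Complex.norm_ofNat]
  ring

theorem sum_abs_mulVec_le {n : Type*} [Fintype n] (M : Matrix n n ℝ) (x : n → ℝ) :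
    ∑ i, |M.mulVec x i| ≤ (∑ i, ∑ j, |M i j|) * ∑ j, |x j| := by
  rw [Finset.sum_mul]
  refine Finset.sum_le_sum fun i _ => ?_
  rw [Matrix.mulVec, dotProduct, Finset.sum_mul]
  refine (Finset.abs_sum_le_sum_abs _ _).trans (Finset.sum_le_sum fun j _ => ?_)
  rw [abs_mul]
  gcongr
  exact Finset.single_le_sum (f := fun j => |x j|) (fun _ _ => abs_nonneg _) (Finset.mem_univ j)

theorem integrable_exp_neg_mul_sum_abs {n : Type*} [Fintype n] {δ : ℝ} (hδ : 0 < δ) :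
    Integrable fun x : n → ℝ => Real.exp (-(δ * ∑ i, |x i|)) := by
  have h1 : Integrable fun t : ℝ => Real.exp (-(δ * |t|)) := by
    rw [← integrableOn_univ, ← Set.Iic_union_Ioi (a := (0 : ℝ))]
    refine IntegrableOn.union ?_ ?_
    · refine (integrableOn_exp_mul_Iic hδ 0).congr_fun (fun t ht => ?_) measurableSet_Iic
      simp [abs_of_nonpos (Set.mem_Iic.1 ht)]
    · refine (integrableOn_exp_mul_Ioi (neg_lt_zero.2 hδ) 0).congr_fun (fun t ht => ?_)
        measurableSet_Ioi
      simp [abs_of_pos (Set.mem_Ioi.1 ht)]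
  have := Integrable.fintype_prod (f := fun (_ : n) (t : ℝ) => Real.exp (-(δ * |t|)))
    (μ := fun _ => volume) (fun _ => h1)
  refine this.congr (Eventually.of_forall fun x => ?_)
  simp only
  rw [← Real.exp_sum, Finset.sum_neg_distrib, Finset.mul_sum]

/-- The state integrals converge absolutely, and depend on the real part of the argument at most
exponentially. -/
theorem exists_norm_stInt_le (k : ℕ) [NeZero k] {b : ℂ} (hb : ‖b‖ = 1) (hr : 0 < b.re)
    (hi : b.im ≠ 0) {α β : Fin 15 → ℝ} (h : PosAngle b α β) :
    ∃ g : (Fin 15 → ℝ) → ℝ, Integrable g ∧ ∀ u m n ν,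
      ‖stInt k b β (shiftArg b fun I => (u I : ℂ) + α I * Complex.I) m n ν‖ ≤
        Real.exp (2 * Real.pi / k * dotProduct u β) * g ν := by
  obtain ⟨α₀, β₀, hoct, hα, hβ⟩ := h
  obtain ⟨C, δ, hC, hδ, hle⟩ := exists_exp_mul_norm_Zprod_le k hb hr hi hoct
  set A := matA.map (Int.cast : ℤ → ℝ) with hA
  set B := matB.map (Int.cast : ℤ → ℝ) with hB
  have hS : matS.map (Int.cast : ℤ → ℝ) = A * B.transpose := by
    have := Matrix.map_mul (L := matA) (M := matB.transpose) (f := Int.castRingHom ℝ)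
    simpa [matS, hA, hB, Matrix.transpose_map] using this
  have hu : IsUnit B.transpose.det := by rw [Matrix.det_transpose]; exact isUnit_det_matB
  -- On this contour the octahedral arguments have imaginary part exactly the octahedral angles
  -- `α₀`.
  have hBβ : -(B.transpose.mulVec β) = α₀ := by
    rw [hβ, Matrix.mulVec_neg, neg_neg, Matrix.mulVec_mulVec,
      Matrix.mul_nonsing_inv _ hu, Matrix.one_mulVec]
  set K := ∑ i, ∑ j, |B.transpose⁻¹ i j| with hK
  have hK0 : 0 ≤ K := Finset.sum_nonneg fun _ _ => Finset.sum_nonneg fun _ _ => abs_nonneg _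
  -- `K` bounds the linear map `x ↦ ν` in the `ℓ¹` norm, so decay in `x` at rate `δ` becomes decay
  -- in `ν`; `K + 1` avoids dividing by a possible zero.
  refine ⟨fun ν => 4 * (C * Real.exp (-(δ / (K + 1) * ∑ I, |ν I|))),
    ((integrable_exp_neg_mul_sum_abs (by positivity)).const_mul C).const_mul 4,
    fun u m n ν => ?_⟩
  rw [shiftArg_eq, norm_stInt, hBβ]
  refine mul_le_mul_of_nonneg_left (mul_le_mul_of_nonneg_left ?_ (by norm_num))
    (Real.exp_pos _).le
  set x := -(B.transpose.mulVec ν) with hx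
  have hν : ν = B.transpose⁻¹.mulVec (-x) := by
    rw [hx, neg_neg, Matrix.mulVec_mulVec, Matrix.nonsing_inv_mul _ hu, Matrix.one_mulVec]
  -- After removing the shift `(Q/2) t`, the linear term is `A α₀ + B β₀`, and the quadratic phase
  -- contributes `A Bᵀ β = -A α₀`. What remains, `ν · B β₀ = -β₀ · x`, is the weight for which the
  -- octahedra decay.
  have hexp : dotProduct ν ((fun I => α I - Qb b / 2 * vecT I) +
      (matS.map (Int.cast : ℤ → ℝ)).mulVec β) = -∑ I, β₀ I * x I := by
    have e1 : (fun I => α I - Qb b / 2 * vecT I) = A.mulVec α₀ + B.mulVec β₀ := by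
      ext I
      rw [hα]
      simp
    have e2 : (matS.map (Int.cast : ℤ → ℝ)).mulVec β = -A.mulVec α₀ := by
      rw [hS, ← Matrix.mulVec_mulVec, ← hBβ, Matrix.mulVec_neg, neg_neg]
    rw [e1, e2, add_neg_cancel_comm, Matrix.dotProduct_mulVec, ← Matrix.mulVec_transpose, hx,
      dotProduct, ← Finset.sum_neg_distrib]
    exact Finset.sum_congr rfl fun I _ => by rw [Pi.neg_apply]; ring
  rw [hexp, mul_neg]
  refine (hle x _).trans (mul_le_mul_of_nonneg_left (Real.exp_le_exp.2 (neg_le_neg ?_)) hC)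
  have h1 : ∑ I, |ν I| ≤ (K + 1) * ∑ I, |x I| := by
    have := sum_abs_mulVec_le B.transpose⁻¹ (-x)
    rw [← hν] at this
    simp only [Pi.neg_apply, abs_neg] at this
    have h0 : 0 ≤ ∑ I, |x I| := Finset.sum_nonneg fun _ _ => abs_nonneg _
    linarith
  rw [div_mul_eq_mul_div, div_le_iff₀ (by positivity), mul_assoc, mul_comm _ (K + 1)]
  exact mul_le_mul_of_nonneg_left h1 hδ.le

theorem integrable_stInt (k : ℕ) [NeZero k] {b : ℂ} (hb : ‖b‖ = 1) (hr : 0 < b.re)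
    (hi : b.im ≠ 0) {α β : Fin 15 → ℝ} (h : PosAngle b α β) (u : Fin 15 → ℝ)
    (m n : Fin 15 → ZMod k) :
    Integrable (stInt k b β (shiftArg b fun I => (u I : ℂ) + α I * Complex.I) m n) := by
  obtain ⟨g, hg, hle⟩ := exists_norm_stInt_le k hb hr hi h
  refine (hg.const_mul (Real.exp (2 * Real.pi / k * dotProduct u β))).mono'
    ?_ (Eventually.of_forall (hle u m n))
  exact ((measurable_stInt k hb hr hi β m n).comp measurable_prodMk_left).aestronglyMeasurable

theorem exists_norm_ZS3_le (k : ℕ) [NeZero k] {b : ℂ} (hb : ‖b‖ = 1) (hr : 0 < b.re)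
    (hi : b.im ≠ 0) {α β : Fin 15 → ℝ} (h : PosAngle b α β) :
    ∃ C, ∀ (u : Fin 15 → ℝ) m, ‖ZS3 k b β (fun I => (u I : ℂ) + α I * Complex.I) m‖ ≤
      C * Real.exp (2 * Real.pi / k * dotProduct u β) := by
  obtain ⟨g, hg, hle⟩ := exists_norm_stInt_le k hb hr hi h
  refine ⟨‖1 / (k : ℂ) ^ 15‖ * ∑ _n : Fin 15 → ZMod k, ∫ ν, g ν, fun u m => ?_⟩
  rw [ZS3, Z3, norm_mul, mul_assoc, Finset.sum_mul]
  gcongr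
  refine (norm_sum_le _ _).trans (Finset.sum_le_sum fun n _ => ?_)
  rw [mul_comm, ← integral_const_mul]
  exact norm_integral_le_of_norm_le (hg.const_mul _) (Eventually.of_forall (hle u m n))

/-- Joint measurability of the integrand suffices: an integral over one variable is measurable in
the other. -/
theorem stronglyMeasurable_ZS3 (k : ℕ) [NeZero k] {b : ℂ} (hb : ‖b‖ = 1) (hr : 0 < b.re)
    (hi : b.im ≠ 0) (β : Fin 15 → ℝ) (m : Fin 15 → ZMod k) :
    StronglyMeasurable fun μ => ZS3 k b β μ m := by
  unfold ZS3 Z3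
  refine (Finset.stronglyMeasurable_fun_sum _ fun n _ => ?_).const_mul _
  have h1 := (measurable_stInt k hb hr hi β m n).stronglyMeasurable.integral_prod_right'
    (ν := volume)
  refine h1.comp_measurable (Continuous.measurable ?_)
  fun_prop

/-! ### The vertex amplitude -/

/-- Expanding the square in `A - 2πn` leaves a Gaussian prefactor times a theta series with `τ = i
k`, whose continuity is known. -/
theorem cohZ_eq (k : ℕ) [NeZero k] (x y : ℝ) (m : ZMod k) :
    cohZ k x y m = (((2 / (k : ℝ)) ^ (1 / 4 : ℝ) : ℝ) : ℂ) *
      Complex.exp (-Complex.I * k * x * y / (4 * Real.pi)) *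
      (Complex.exp (-(k : ℂ) / (4 * Real.pi) * (2 * Real.pi * (m.val : ℂ) / k - x) ^ 2 -
        Complex.I * k / (2 * Real.pi) * y * (2 * Real.pi * (m.val : ℂ) / k - x)) *
      jacobiTheta₂ (k * (y - Complex.I * (2 * Real.pi * (m.val : ℂ) / k - x)) / (2 * Real.pi))
        (Complex.I * k)) := by
  have hpi : (Real.pi : ℂ) ≠ 0 := Complex.ofReal_ne_zero.2 Real.pi_ne_zero
  rw [cohZ, jacobiTheta₂, ← tsum_mul_left (a := Complex.exp _)]
  congr 1
  refine tsum_congr fun n => ?_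
  rw [jacobiTheta₂_term, ← Complex.exp_add, ← Complex.exp_add]
  congr 1
  obtain ⟨A, hA⟩ : ∃ A : ℂ, A = 2 * Real.pi * (m.val : ℂ) / k - x := ⟨_, rfl⟩
  have hn : 2 * Real.pi * (m.val : ℂ) / k - 2 * Real.pi * n - x = A - 2 * Real.pi * n := by
    rw [hA]; ring
  rw [hn, ← hA]
  field_simp
  linear_combination k * 8 * Real.pi * n * (A - Real.pi * n) * Complex.I_sq

theorem continuous_cohZ (k : ℕ) [NeZero k] (m : ZMod k) :
    Continuous fun p : ℝ × ℝ => cohZ k p.1 p.2 m := by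
  simp only [cohZ_eq]
  have hτ : 0 < (Complex.I * k).im := by simpa using NeZero.pos k
  have hθ : Continuous fun z => jacobiTheta₂ z (Complex.I * k) :=
    continuous_iff_continuousAt.2 fun z => (differentiableAt_jacobiTheta₂_fst z hτ).continuousAt
  refine Continuous.mul (by fun_prop) (Continuous.mul (by fun_prop) (hθ.comp ?_))
  fun_prop

theorem exists_norm_cohZ_le (k : ℕ) [NeZero k] (R : ℝ) :
    ∃ C, 0 ≤ C ∧ ∀ x y m, |x| ≤ R → |y| ≤ R → ‖cohZ k x y m‖ ≤ C := by
  have h : ∀ m, ∃ C, ∀ x y, |x| ≤ R → |y| ≤ R → ‖cohZ k x y m‖ ≤ C := fun m => by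
    obtain ⟨C, hC⟩ := ((isCompact_Icc (a := -R) (b := R)).prod
      (isCompact_Icc (a := -R) (b := R))).exists_bound_of_continuousOn
        (continuous_cohZ k m).continuousOn
    exact ⟨C, fun x y hx hy => hC (x, y) ⟨abs_le.1 hx, abs_le.1 hy⟩⟩
  choose C hC using h
  refine ⟨∑ m, |C m|, Finset.sum_nonneg fun _ _ => abs_nonneg _, fun x y m hx hy => ?_⟩
  exact (hC m x y hx hy).trans ((le_abs_self _).trans
    (Finset.single_le_sum (f := fun m => |C m|) (fun _ _ => abs_nonneg _) (Finset.mem_univ m)))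

theorem continuous_cohR (k : ℕ) (β : ℝ) : Continuous fun p : ℂ × ℝ => cohR k β p.1 p.2 := by
  unfold cohR
  fun_prop

/-- Completing the square: with `μ₀ = k Re z / (π√2)`, the prefactor's exponent `√2 β Re z` equals
`(2π/k) μ₀ β`, so the growth factor only sees `μ - μ₀`. The label moves the centre of the Gaussian
but not its height. -/
theorem exp_mul_norm_cohR (k : ℕ) [NeZero k] (β : ℝ) (z : ℂ) (μ : ℝ) :
    Real.exp (2 * Real.pi / k * (μ * β)) * ‖cohR k β z μ‖ =
      (2 / (k : ℝ)) ^ (1 / 4 : ℝ) * Real.exp (Real.pi / k * β ^ 2) *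
        Real.exp (-(Real.pi / k) * (μ - (k / (Real.pi * Real.sqrt 2) * z.re + β)) ^ 2) := by
  have hk : (k : ℝ) ≠ 0 := Nat.cast_ne_zero.2 (NeZero.ne k)
  have hs : Real.sqrt 2 ≠ 0 := by positivity
  rw [cohR, norm_mul, mul_comm Complex.I, Complex.norm_exp_ofReal_mul_I, mul_one,
    Complex.norm_real, Real.norm_of_nonneg (by positivity), mul_assoc _ (Real.exp (_ * β ^ 2)),
    ← Real.exp_add]
  have : ∀ a b c d : ℝ, a * (b * c * d) = c * (a * b * d) := fun a b c d => by ring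
  rw [this, ← Real.exp_add, ← Real.exp_add]
  congr 2
  have hs2 : Real.sqrt 2 * β * z.re =
      2 * Real.pi / k * (k / (Real.pi * Real.sqrt 2) * z.re * β) := by
    field_simp
    rw [Real.sq_sqrt zero_le_two]
    ring
  linear_combination (-1 : ℝ) * hs2

theorem integrable_gaussian (k : ℕ) [NeZero k] (μ₀ : ℝ) :
    Integrable fun μ : ℝ => Real.exp (-(Real.pi / k) * (μ - μ₀) ^ 2) := by
  have hk : (0 : ℝ) < k := Nat.cast_pos.2 (NeZero.pos k)
  exact (integrable_exp_neg_mul_sq (div_pos Real.pi_pos hk)).comp_sub_right μ₀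

theorem dotProduct_joinVec_zero (μ : Fin 5 → ℝ) (β : Fin 15 → ℝ) :
    dotProduct (joinVec (fun _ => 0) μ) β = ∑ a, μ a * β (sphIdx a) := by
  have h := Fin.sum_univ_add (a := 10) (b := 5) fun I : Fin (10 + 5) =>
    joinVec (fun _ => (0 : ℝ)) μ I * β I
  refine h.trans ?_
  simp only [joinVec, Fin.append_left, Fin.append_right, zero_mul, Finset.sum_const_zero, zero_add]
  rfl

theorem exists_norm_vertexInt_le (k : ℕ) [NeZero k] {b : ℂ} (hb : ‖b‖ = 1) (hr : 0 < b.re)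
    (hi : b.im ≠ 0) {α β : Fin 15 → ℝ} (h : PosAngle b α β) :
    ∃ C, 0 ≤ C ∧ ∀ d ρ m μ, ‖vertexInt k b α β d ρ m μ‖ ≤
      C * (∏ a, ‖cohZ k (ρ a).x (ρ a).y (m a)‖) *
        ∏ a, Real.exp (-(Real.pi / k) *
          (μ a - (k / (Real.pi * Real.sqrt 2) * (ρ a).z.re + β (sphIdx a))) ^ 2) := by
  obtain ⟨C, hC⟩ := exists_norm_ZS3_le k hb hr hi h
  have hC0 : 0 ≤ C := by simpa using (norm_nonneg _).trans (hC 0 0)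
  refine ⟨C * ∏ a : Fin 5, ((2 / (k : ℝ)) ^ (1 / 4 : ℝ) * Real.exp (Real.pi / k * β (sphIdx a) ^ 2)),
    by positivity, fun d ρ m μ => ?_⟩
  rw [vertexInt, norm_mul, norm_prod]
  refine (mul_le_mul_of_nonneg_right (hC _ _) (by positivity)).trans_eq ?_
  have := dotProduct_joinVec_zero μ β
  rw [this, Finset.mul_sum, Real.exp_sum, mul_assoc, ← Finset.prod_mul_distrib, mul_assoc, mul_assoc,
    ← Finset.prod_mul_distrib, ← Finset.prod_mul_distrib]
  congr 1
  refine Finset.prod_congr rfl fun a _ => ?_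
  rw [norm_mul, ← mul_assoc, exp_mul_norm_cohR]
  ring

theorem measurable_joinVec_zero (I : Fin 15) :
    Measurable fun μ : Fin 5 → ℝ => joinVec (fun _ => 0) μ I := by
  refine Fin.addCases (m := 10) (n := 5)
    (motive := fun I => Measurable fun μ : Fin 5 → ℝ => joinVec (fun _ => 0) μ I) ?_ ?_ I
  · intro i
    simp only [joinVec, Fin.append_left]
    exact measurable_const
  · intro a
    simp only [joinVec, Fin.append_right]
    exact measurable_pi_apply _

theorem measurable_vertexInt {T : Type*} [MeasurableSpace T] (k : ℕ) [NeZero k] {b : ℂ}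
    (hb : ‖b‖ = 1) (hr : 0 < b.re) (hi : b.im ≠ 0) (α β : Fin 15 → ℝ) (d : Fin 5 → Fin 5 → ℕ)
    {ρ : T → Fin 5 → CohLabel} (hz : ∀ a, Measurable fun t => (ρ t a).z)
    (hx : ∀ a, Measurable fun t => (ρ t a).x) (hy : ∀ a, Measurable fun t => (ρ t a).y)
    (m : Fin 5 → ZMod k) :
    Measurable fun p : T × (Fin 5 → ℝ) => vertexInt k b α β d (ρ p.1) m p.2 := by
  unfold vertexInt
  refine Measurable.mul ?_ (Finset.measurable_prod _ fun a _ => Measurable.mul ?_ ?_)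
  · have hS := (stronglyMeasurable_ZS3 k hb hr hi β (joinVec (annM k d) m)).measurable
    have hg : Measurable fun p : T × (Fin 5 → ℝ) => fun I =>
        ((joinVec (fun _ => 0) p.2 I : ℝ) : ℂ) + α I * Complex.I :=
      measurable_pi_lambda _ fun I => (Complex.measurable_ofReal.comp
        ((measurable_joinVec_zero I).comp measurable_snd)).add measurable_const
    exact hS.comp hg
  · have hg : Measurable fun p : T × (Fin 5 → ℝ) => ((ρ p.1 a).z, p.2 a) :=
      ((hz a).comp measurable_fst).prodMk ((measurable_pi_apply a).comp measurable_snd)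
    exact (continuous_cohR k (β (sphIdx a))).measurable.comp hg
  · have hg : Measurable fun p : T × (Fin 5 → ℝ) => ((ρ p.1 a).x, (ρ p.1 a).y) :=
      ((hx a).comp measurable_fst).prodMk ((hy a).comp measurable_fst)
    have h := (continuous_cohZ k (m a)).measurable.comp hg
    simpa only [Function.comp_def] using h

theorem integrable_vertexInt (k : ℕ) [NeZero k] {b : ℂ} (hb : ‖b‖ = 1) (hr : 0 < b.re)
    (hi : b.im ≠ 0) {α β : Fin 15 → ℝ} (h : PosAngle b α β) (d : Fin 5 → Fin 5 → ℕ)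
    (ρ : Fin 5 → CohLabel) (m : Fin 5 → ZMod k) : Integrable (vertexInt k b α β d ρ m) := by
  obtain ⟨C, _, hC⟩ := exists_norm_vertexInt_le k hb hr hi h
  refine ((Integrable.fintype_prod (μ := fun _ => volume) fun a : Fin 5 =>
    integrable_gaussian k (k / (Real.pi * Real.sqrt 2) * (ρ a).z.re + β (sphIdx a))).const_mul
      _).mono' ?_ (Eventually.of_forall (hC d ρ m))
  exact ((measurable_vertexInt k hb hr hi α β d (T := Unit) (ρ := fun _ => ρ)
    (fun _ => measurable_const) (fun _ => measurable_const) (fun _ => measurable_const) m).comp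
    (measurable_prodMk_left (x := ()))).aestronglyMeasurable

/-- The pointwise bound is a product of Gaussians whose centres alone depend on `z`, so their
integrals do not; `x` and `y` enter through theta functions bounded on compact sets. -/
theorem exists_norm_vertexAmp_le (k : ℕ) [NeZero k] {b : ℂ} (hb : ‖b‖ = 1) (hr : 0 < b.re)
    (hi : b.im ≠ 0) {α β : Fin 15 → ℝ} (h : PosAngle b α β) (R : ℝ) :
    ∃ C, ∀ d ρ, (∀ a, |(ρ a).x| ≤ R) → (∀ a, |(ρ a).y| ≤ R) →
      ‖vertexAmp k b α β d ρ‖ ≤ C := by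
  obtain ⟨C, hC0, hC⟩ := exists_norm_vertexInt_le k hb hr hi h
  obtain ⟨D, hD0, hD⟩ := exists_norm_cohZ_le k R
  refine ⟨∑ _m : Fin 5 → ZMod k, C * (∏ _a : Fin 5, D) *
    ∏ _a : Fin 5, ∫ μ : ℝ, Real.exp (-(Real.pi / k) * μ ^ 2), fun d ρ hx hy => ?_⟩
  refine (norm_sum_le _ _).trans (Finset.sum_le_sum fun m _ => ?_)
  have hint := Integrable.fintype_prod (μ := fun _ => volume) fun a : Fin 5 =>
    integrable_gaussian k (k / (Real.pi * Real.sqrt 2) * (ρ a).z.re + β (sphIdx a))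
  refine (norm_integral_le_of_norm_le (hint.const_mul _)
    (Eventually.of_forall (hC d ρ m))).trans ?_
  rw [integral_const_mul]
  have e := integral_fintype_prod_volume_eq_prod fun (a : Fin 5) (μ : ℝ) =>
    Real.exp (-(Real.pi / k) *
      (μ - (k / (Real.pi * Real.sqrt 2) * (ρ a).z.re + β (sphIdx a))) ^ 2)
  refine (congrArg _ e).trans_le ?_
  -- Translation invariance of Lebesgue measure removes the last dependence on `z`.
  simp only [integral_sub_right_eq_self (fun μ : ℝ => Real.exp (-(Real.pi / k) * μ ^ 2))]
  refine mul_le_mul_of_nonneg_right (mul_le_mul_of_nonneg_left ?_ hC0)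
    (Finset.prod_nonneg fun a _ => integral_nonneg fun _ => (Real.exp_pos _).le)
  exact Finset.prod_le_prod (fun a _ => norm_nonneg _) fun a _ => hD _ _ _ (hx a) (hy a)

theorem stronglyMeasurable_vertexAmp {T : Type*} [MeasurableSpace T] (k : ℕ) [NeZero k] {b : ℂ}
    (hb : ‖b‖ = 1) (hr : 0 < b.re) (hi : b.im ≠ 0) (α β : Fin 15 → ℝ) (d : Fin 5 → Fin 5 → ℕ)
    {ρ : T → Fin 5 → CohLabel} (hz : ∀ a, Measurable fun t => (ρ t a).z)
    (hx : ∀ a, Measurable fun t => (ρ t a).x) (hy : ∀ a, Measurable fun t => (ρ t a).y) :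
    StronglyMeasurable fun t => vertexAmp k b α β d (ρ t) := by
  unfold vertexAmp
  exact Finset.stronglyMeasurable_fun_sum _ fun m _ =>
    (measurable_vertexInt k hb hr hi α β d hz hx hy m).stronglyMeasurable.integral_prod_right'

/-! ### Geodesic polygons -/

/-- This is the spherical law of cosines. The triangle inequalities place `cos r` between `cos (p +
θ)` and `cos (p - θ)`, which is what keeps the argument of `arccos` in `[-1, 1]`. -/
theorem sin_mul_sin_mul_cos_sphAngle {p θ r : ℝ} (hp0 : 0 ≤ p) (hpi : p ≤ Real.pi) (h0 : 0 ≤ θ)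
    (hi : θ ≤ Real.pi) (hr0 : 0 ≤ r) (hri : r ≤ Real.pi) (h1 : |p - r| ≤ θ) (h2 : θ ≤ p + r)
    (h3 : θ ≤ 2 * Real.pi - p - r) :
    Real.sin p * Real.sin θ * Real.cos (sphAngle p θ r) =
      Real.cos r - Real.cos p * Real.cos θ := by
  obtain ⟨h1, h1'⟩ := abs_le.1 h1
  have hle : Real.cos r ≤ Real.cos (p - θ) := by
    rw [← Real.cos_abs (p - θ)]
    exact Real.cos_le_cos_of_nonneg_of_le_pi (abs_nonneg _) hri
      (abs_le.2 ⟨by linarith, by linarith⟩)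
  have hge : Real.cos (p + θ) ≤ Real.cos r := by
    rcases le_total (p + θ) Real.pi with h | h
    · exact Real.cos_le_cos_of_nonneg_of_le_pi hr0 h (by linarith)
    · rw [← Real.cos_two_pi_sub]
      exact Real.cos_le_cos_of_nonneg_of_le_pi hr0 (by linarith) (by linarith)
  rw [Real.cos_sub] at hle
  rw [Real.cos_add] at hge
  have hs : 0 ≤ Real.sin p * Real.sin θ :=
    mul_nonneg (Real.sin_nonneg_of_nonneg_of_le_pi hp0 hpi)
      (Real.sin_nonneg_of_nonneg_of_le_pi h0 hi)
  -- For a degenerate triangle the two bounds on `cos r` coincide, and the identity holds whatever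
  -- value `sphAngle` takes.
  rcases hs.eq_or_lt with h | h
  · rw [← h] at hle hge ⊢
    linarith
  · rw [sphAngle, Real.cos_arccos, mul_div_cancel₀ _ h.ne']
    · rw [le_div_iff₀ h]; linarith
    · rw [div_le_iff₀ h]; linarith

theorem star_quat (v : Fin 4 → ℝ) : star (quat v) = quat ![v 0, -v 1, -v 2, -v 3] := by
  ext i j
  rw [Matrix.star_apply]
  fin_cases i <;> fin_cases j <;> simp [quat]

theorem quat_mul_star (u v : Fin 4 → ℝ) :
    (quat u * star (quat v)).trace =
      ((2 * (u 0 * v 0 + u 1 * v 1 + u 2 * v 2 + u 3 * v 3) : ℝ) : ℂ) := by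
  rw [star_quat, Matrix.trace_fin_two, Matrix.mul_apply, Matrix.mul_apply, Fin.sum_univ_two,
    Fin.sum_univ_two]
  simp [quat, Complex.ext_iff]
  constructor <;> ring

theorem quat_mem {v : Fin 4 → ℝ} (hv : v 0 ^ 2 + v 1 ^ 2 + v 2 ^ 2 + v 3 ^ 2 = 1) :
    quat v ∈ Matrix.specialUnitaryGroup (Fin 2) ℂ := by
  rw [Matrix.mem_specialUnitaryGroup_iff, Matrix.mem_unitaryGroup_iff]
  constructor
  · rw [star_quat]
    ext i j
    rw [Matrix.mul_apply, Fin.sum_univ_two]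
    fin_cases i <;> fin_cases j <;> simp [quat, Complex.ext_iff] <;>
      constructor <;> linarith
  · rw [Matrix.det_fin_two]
    simp [quat, Complex.ext_iff]
    constructor <;> linarith

theorem star_mul_self_of_mem {g : Matrix (Fin 2) (Fin 2) ℂ}
    (hg : g ∈ Matrix.specialUnitaryGroup (Fin 2) ℂ) : star g * g = 1 :=
  Matrix.mem_unitaryGroup_iff'.1 hg.1

theorem inv_eq_star_of_mem {g : Matrix (Fin 2) (Fin 2) ℂ}
    (hg : g ∈ Matrix.specialUnitaryGroup (Fin 2) ℂ) : g⁻¹ = star g :=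
  Matrix.inv_eq_left_inv (star_mul_self_of_mem hg)

theorem star_mem_specialUnitaryGroup {g : Matrix (Fin 2) (Fin 2) ℂ}
    (hg : g ∈ Matrix.specialUnitaryGroup (Fin 2) ℂ) :
    star g ∈ Matrix.specialUnitaryGroup (Fin 2) ℂ :=
  (star (⟨g, hg⟩ : Matrix.specialUnitaryGroup (Fin 2) ℂ)).2

theorem trace_quat (v : Fin 4 → ℝ) : (quat v).trace = ((2 * v 0 : ℝ) : ℂ) := by
  rw [Matrix.trace_fin_two]
  simp [quat, Complex.ext_iff]
  ring

theorem edgeLen_nonneg (k : ℕ) (d : Fin 4 → ℕ) (i : Fin 4) : 0 ≤ edgeLen k d i := by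
  unfold edgeLen; positivity

theorem edgeLen_le_pi {k : ℕ} {d : Fin 4 → ℕ} {i : Fin 4} (h : d i < k) :
    edgeLen k d i ≤ Real.pi := by
  have hk : (0 : ℝ) < k := by exact_mod_cast (Nat.zero_le _).trans_lt h
  rw [edgeLen, div_le_iff₀ hk]
  exact mul_le_mul_of_nonneg_left (by exact_mod_cast h.le) Real.pi_pos.le

/-- The diagonal cuts the 4-gon into spherical triangles with sides `a₁, a₂, θ` and `a₄, a₃, θ`. The
law of cosines in each gives the traces of the second and third holonomies, and the product relation
telescopes; degenerate 4-gons are included. -/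
theorem polygon_mem_su2Conn {k : ℕ} {d : Fin 4 → ℕ} (hd : ∀ i, d i < k) {p : ℝ × ℝ}
    (hp : p ∈ polyDomain k d) : polygon k d p ∈ su2Conn k d := by
  have ha0 := edgeLen_nonneg k d
  have hai : ∀ i, edgeLen k d i ≤ Real.pi := fun i => edgeLen_le_pi (hd i)
  obtain ⟨⟨h1, h2⟩, -⟩ := hp
  obtain ⟨h1, h1'⟩ := max_le_iff.1 h1
  obtain ⟨h2, h3⟩ := le_min_iff.1 h2
  obtain ⟨h2, h2'⟩ := le_min_iff.1 h2
  obtain ⟨h3, h3'⟩ := le_min_iff.1 h3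
  have hθ0 : 0 ≤ p.1 := (abs_nonneg _).trans h1
  have hθi : p.1 ≤ Real.pi := by linarith
  have hA := sin_mul_sin_mul_cos_sphAngle (ha0 0) (hai 0) hθ0 hθi (ha0 1) (hai 1) h1 h2 h2'
  have hB := sin_mul_sin_mul_cos_sphAngle (ha0 3) (hai 3) hθ0 hθi (ha0 2) (hai 2)
    (by rw [abs_sub_comm]; exact h1') (by linarith) (by linarith)
  set A := sphAngle (edgeLen k d 0) p.1 (edgeLen k d 1)
  set B := sphAngle (edgeLen k d 3) p.1 (edgeLen k d 2)
  set u₂ : Fin 4 → ℝ := ![Real.cos (edgeLen k d 0), Real.sin (edgeLen k d 0) * Real.sin A, 0,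
    Real.sin (edgeLen k d 0) * Real.cos A] with hu₂
  set u₃ : Fin 4 → ℝ := ![Real.cos p.1, 0, 0, Real.sin p.1] with hu₃
  set u₄ : Fin 4 → ℝ := ![Real.cos (edgeLen k d 3),
    Real.sin (edgeLen k d 3) * (Real.sin B * Real.cos p.2),
    Real.sin (edgeLen k d 3) * (Real.sin B * Real.sin p.2),
    Real.sin (edgeLen k d 3) * Real.cos B] with hu₄
  have hv₂ : quat u₂ ∈ Matrix.specialUnitaryGroup (Fin 2) ℂ := quat_mem (by
    simp [hu₂]
    linear_combination Real.sin_sq_add_cos_sq (edgeLen k d 0) +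
      Real.sin (edgeLen k d 0) ^ 2 * Real.sin_sq_add_cos_sq A)
  have hv₃ : quat u₃ ∈ Matrix.specialUnitaryGroup (Fin 2) ℂ := quat_mem (by simp [hu₃])
  have hv₄ : quat u₄ ∈ Matrix.specialUnitaryGroup (Fin 2) ℂ := quat_mem (by
    simp [hu₄]
    linear_combination Real.sin_sq_add_cos_sq (edgeLen k d 3) +
      Real.sin (edgeLen k d 3) ^ 2 * Real.sin_sq_add_cos_sq B +
      Real.sin (edgeLen k d 3) ^ 2 * Real.sin B ^ 2 * Real.sin_sq_add_cos_sq p.2)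
  have hpoly : polygon k d p =
      ![quat u₂, quat u₃ * star (quat u₂), quat u₄ * star (quat u₃), star (quat u₄)] := by
    rw [← inv_eq_star_of_mem hv₂, ← inv_eq_star_of_mem hv₃, ← inv_eq_star_of_mem hv₄]
    rfl
  rw [hpoly]
  refine ⟨fun i => ?_, ?_⟩
  · fin_cases i
    · exact ⟨hv₂, trace_quat u₂⟩
    · refine ⟨mul_mem hv₃ (star_mem_specialUnitaryGroup hv₂), ?_⟩
      refine (quat_mul_star _ _).trans (congrArg _ ?_)
      change _ = 2 * Real.cos (edgeLen k d 1)
      simp [hu₂, hu₃]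
      linear_combination hA
    · refine ⟨mul_mem hv₄ (star_mem_specialUnitaryGroup hv₃), ?_⟩
      refine (quat_mul_star _ _).trans (congrArg _ ?_)
      change _ = 2 * Real.cos (edgeLen k d 2)
      simp [hu₄, hu₃]
      linear_combination hB
    · refine ⟨star_mem_specialUnitaryGroup hv₄, ?_⟩
      change (star (quat u₄)).trace = ((2 * Real.cos (edgeLen k d 3) : ℝ) : ℂ)
      rw [star_quat, trace_quat]
      simp [hu₄]
  · change star (quat u₄) * (quat u₄ * star (quat u₃)) * (quat u₃ * star (quat u₂)) * quat u₂ = 1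
    have e₂ := star_mul_self_of_mem hv₂
    have e₃ := star_mul_self_of_mem hv₃
    have e₄ := star_mul_self_of_mem hv₄
    rw [← Matrix.mul_assoc (star (quat u₄)), e₄, Matrix.one_mul,
      ← Matrix.mul_assoc (star (quat u₃)), e₃, Matrix.one_mul, e₂]

theorem isCompact_su2Conn (k : ℕ) (d : Fin 4 → ℕ) : IsCompact (su2Conn k d) := by
  have hK : IsCompact (Set.univ.pi fun _ : Fin 4 => Set.univ.pi fun _ : Fin 2 =>
      Set.univ.pi fun _ : Fin 2 => Metric.closedBall (0 : ℂ) 1) :=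
    isCompact_univ_pi fun _ => isCompact_univ_pi fun _ => isCompact_univ_pi fun _ =>
      isCompact_closedBall _ _
  have hcont : ∀ i, Continuous fun H : Hol => H i := fun i => continuous_apply i
  refine IsCompact.of_isClosed_subset (X := Hol) hK ?_ ?_
  · have : su2Conn k d = (⋂ i, ({H | H i * star (H i) = 1} ∩ {H | (H i).det = 1} ∩
        {H | (H i).trace = ((2 * Real.cos (Real.pi * d i / k) : ℝ) : ℂ)})) ∩
        {H | H 3 * H 2 * H 1 * H 0 = 1} := by
      ext H
      simp only [su2Conn, Matrix.mem_specialUnitaryGroup_iff, Matrix.mem_unitaryGroup_iff,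
        Set.mem_ofPred_eq, Set.mem_inter_iff, Set.mem_iInter]
    rw [this]
    refine IsClosed.inter (isClosed_iInter fun i => ((isClosed_eq ?_ continuous_const).inter
      (isClosed_eq ?_ continuous_const)).inter (isClosed_eq ?_ continuous_const))
      (isClosed_eq ?_ continuous_const)
    · exact (hcont i).matrix_mul (hcont i).star
    · exact (hcont i).matrix_det
    · exact (hcont i).matrix_trace
    · exact (((hcont 3).matrix_mul (hcont 2)).matrix_mul (hcont 1)).matrix_mul (hcont 0)
  · intro H hH i _ r _ s _
    rw [mem_closedBall_zero_iff]
    exact entry_norm_bound_of_unitary (hH.1 i).1.1 r s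

/-! ### Measurability of the coherent state labels -/

section Measurability

variable {T : Type*} [MeasurableSpace T]

theorem measurable_matrix_mul {A B : T → Matrix (Fin 2) (Fin 2) ℂ}
    (hA : ∀ r s, Measurable fun t => A t r s) (hB : ∀ r s, Measurable fun t => B t r s)
    (r s : Fin 2) : Measurable fun t => (A t * B t) r s := by
  simp only [Matrix.mul_apply]
  exact Finset.measurable_sum _ fun j _ => (hA r j).mul (hB j s)

theorem measurable_matrix_inv {A : T → Matrix (Fin 2) (Fin 2) ℂ}
    (hA : ∀ r s, Measurable fun t => A t r s) (r s : Fin 2) :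
    Measurable fun t => (A t)⁻¹ r s := by
  simp only [Matrix.inv_def, Ring.inverse_eq_inv', Matrix.smul_apply, smul_eq_mul,
    Matrix.det_fin_two, Matrix.adjugate_fin_two]
  have h := hA
  refine Measurable.mul (by fun_prop) ?_
  fin_cases r <;> fin_cases s <;> simp <;> fun_prop

theorem measurable_mulVec {A : T → Matrix (Fin 2) (Fin 2) ℂ} {v : T → Fin 2 → ℂ}
    (hA : ∀ r s, Measurable fun t => A t r s) (hv : ∀ r, Measurable fun t => v t r) (r : Fin 2) :
    Measurable fun t => (A t).mulVec (v t) r := by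
  simp only [Matrix.mulVec, dotProduct]
  exact Finset.measurable_sum _ fun j _ => (hA r j).mul (hv j)

theorem measurable_quat {v : T → Fin 4 → ℝ} (hv : ∀ i, Measurable fun t => v t i) (r s : Fin 2) :
    Measurable fun t => quat (v t) r s := by
  have h := fun i => Complex.measurable_ofReal.comp (hv i)
  simp only [Function.comp_def] at h
  fin_cases r <;> fin_cases s <;> simp [quat] <;> fun_prop

theorem measurable_polygon (k : ℕ) (d : Fin 4 → ℕ) {p : T → ℝ × ℝ} (hp : Measurable p)
    (i : Fin 4) (r s : Fin 2) : Measurable fun t => polygon k d (p t) i r s := by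
  have h1 : Measurable fun t => (p t).1 := measurable_fst.comp hp
  have h2 : Measurable fun t => (p t).2 := measurable_snd.comp hp
  have hang : ∀ a c : ℝ, Measurable fun t => sphAngle a (p t).1 c := fun a c => by
    unfold sphAngle
    exact Real.continuous_arccos.measurable.comp (by fun_prop)
  have hA := hang (edgeLen k d 0) (edgeLen k d 1)
  have hB := hang (edgeLen k d 3) (edgeLen k d 2)
  have hv₂ := measurable_quat (v := fun t => ![Real.cos (edgeLen k d 0),
    Real.sin (edgeLen k d 0) * Real.sin (sphAngle (edgeLen k d 0) (p t).1 (edgeLen k d 1)), 0,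
    Real.sin (edgeLen k d 0) * Real.cos (sphAngle (edgeLen k d 0) (p t).1 (edgeLen k d 1))])
    (fun i => by fin_cases i <;> simp <;> fun_prop)
  have hv₃ := measurable_quat (v := fun t => ![Real.cos (p t).1, 0, 0, Real.sin (p t).1])
    (fun i => by fin_cases i <;> simp <;> fun_prop)
  have hv₄ := measurable_quat (v := fun t => ![Real.cos (edgeLen k d 3),
    Real.sin (edgeLen k d 3) * (Real.sin (sphAngle (edgeLen k d 3) (p t).1 (edgeLen k d 2)) *
      Real.cos (p t).2),
    Real.sin (edgeLen k d 3) * (Real.sin (sphAngle (edgeLen k d 3) (p t).1 (edgeLen k d 2)) *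
      Real.sin (p t).2),
    Real.sin (edgeLen k d 3) * Real.cos (sphAngle (edgeLen k d 3) (p t).1 (edgeLen k d 2))])
    (fun i => by fin_cases i <;> simp <;> fun_prop)
  fin_cases i
  · exact hv₂ r s
  · exact measurable_matrix_mul hv₃ (measurable_matrix_inv hv₂) r s
  · exact measurable_matrix_mul hv₄ (measurable_matrix_inv hv₃) r s
  · exact measurable_matrix_inv hv₄ r s

variable {H : T → Hol}

/-- The chosen eigenvector is discontinuous where the off-diagonal entry vanishes, but the case
distinction is along Borel sets. -/
theorem measurable_spinor {A : T → Matrix (Fin 2) (Fin 2) ℂ}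
    (hA : ∀ r s, Measurable fun t => A t r s) (l : ℂ) (j : Fin 2) :
    Measurable fun t => spinor (A t) l j := by
  have h1 : MeasurableSet {t | A t 0 1 ≠ 0} := (hA 0 1 (measurableSet_singleton 0)).compl
  have h2 : MeasurableSet {t | A t 0 0 = l} := hA 0 0 (measurableSet_singleton l)
  have h : (fun t => spinor (A t) l j) = fun t => if A t 0 1 ≠ 0 then
      (![A t 0 1, l - A t 0 0] : Fin 2 → ℂ) j else if A t 0 0 = l then
      (![1, 0] : Fin 2 → ℂ) j else (![0, 1] : Fin 2 → ℂ) j := by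
    ext t
    unfold spinor
    split_ifs <;> rfl
  rw [h]
  refine Measurable.ite h1 ?_ (Measurable.ite h2 measurable_const measurable_const)
  have := hA
  fin_cases j <;> simp <;> fun_prop

theorem measurable_conj {f : T → ℂ} (hf : Measurable f) :
    Measurable fun t => (starRingEnd ℂ) (f t) :=
  Complex.continuous_conj.measurable.comp hf

theorem measurable_flag (k : ℕ) (a : Fin 5) (d : Fin 4 → ℕ)
    (hH : ∀ i r s, Measurable fun t => H t i r s) (i : Fin 4) (j : Fin 2) :
    Measurable fun t => flag k a d (H t) i j := by
  have hs := measurable_spinor (hH i) (Complex.exp (Complex.I * (Real.pi * d i / k : ℝ)))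
  unfold flag
  split_ifs
  · exact hs j
  · unfold spinorJ
    have h0 := measurable_conj (hs 0)
    have h1 := (measurable_conj (hs 1)).neg
    fin_cases j
    exacts [h1, h0]

theorem measurable_hol4 (k : ℕ) (b : ℂ) (α : Fin 15 → ℝ) (a : Fin 5) (d : Fin 4 → ℕ)
    (hH : ∀ i r s, Measurable fun t => H t i r s) (r s : Fin 2) :
    Measurable fun t => hol4 k b α a d (H t) r s := by
  have hM : ∀ r s, Measurable fun t => spinorM (flag k a d (H t) 3) r s := by
    intro r s
    have h0 := measurable_flag k a d hH 3 0
    have h1 := measurable_flag k a d hH 3 1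
    have h2 := measurable_conj h0
    have h3 := (measurable_conj h1).neg
    unfold spinorM
    fin_cases r <;> fin_cases s
    exacts [h0, h3, h1, h2]
  simp only [hol4]
  refine measurable_matrix_mul (A := fun t => spinorM (flag k a d (H t) 3) * Matrix.diagonal _)
    (B := fun t => (spinorM (flag k a d (H t) 3))⁻¹) (fun r s => ?_)
    (measurable_matrix_inv hM) r s
  exact measurable_matrix_mul (B := fun _ => Matrix.diagonal _) hM
    (fun _ _ => measurable_const) r s

theorem measurable_fgCoord {r₁ d₁ r₂ d₂ : T → Fin 2 → ℂ} (h₁ : ∀ j, Measurable fun t => r₁ t j)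
    (h₂ : ∀ j, Measurable fun t => d₁ t j) (h₃ : ∀ j, Measurable fun t => r₂ t j)
    (h₄ : ∀ j, Measurable fun t => d₂ t j) :
    Measurable fun t => fgCoord (r₁ t) (d₁ t) (r₂ t) (d₂ t) := by
  unfold fgCoord wedge
  fun_prop

theorem measurable_expX (k : ℕ) (a : Fin 5) (d : Fin 4 → ℕ)
    (hH : ∀ i r s, Measurable fun t => H t i r s) : Measurable fun t => expX k a d (H t) :=
  measurable_fgCoord (measurable_flag k a d hH 0) (measurable_flag k a d hH 1)
    (measurable_flag k a d hH 2) (measurable_flag k a d hH 3)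

theorem measurable_expY (k : ℕ) (b : ℂ) (α : Fin 15 → ℝ) (a : Fin 5) (d : Fin 4 → ℕ)
    (hH : ∀ i r s, Measurable fun t => H t i r s) : Measurable fun t => expY k b α a d (H t) := by
  have hf := measurable_flag k a d hH
  have hO := measurable_hol4 k b α a d hH
  unfold expY
  split_ifs
  · exact (measurable_fgCoord (hf 1) (hf 2)
      (measurable_mulVec (measurable_matrix_inv hO) (hf 0)) (hf 3)).inv
  · exact measurable_fgCoord (measurable_mulVec hO (hf 2)) (hf 0) (hf 1) (hf 3)

theorem measurable_muOf (k : ℕ) (b : ℂ) : Measurable (muOf k b) := by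
  unfold muOf
  fun_prop

theorem measurable_mOf (k : ℕ) (b : ℂ) : Measurable (mOf k b) := by
  have := measurable_muOf k b
  unfold mOf
  fun_prop

theorem measurable_toIcoMod : Measurable fun x => toIcoMod Real.two_pi_pos 0 x := by
  simp only [toIcoMod_eq_fract_mul]
  exact (measurable_fract.comp (measurable_id.div_const _)).mul_const _

theorem measurable_cohLabel (k : ℕ) (b : ℂ) (α : Fin 15 → ℝ) (a : Fin 5) (d : Fin 4 → ℕ)
    (hH : ∀ i r s, Measurable fun t => H t i r s) :
    (Measurable fun t => (cohLabel k b α a d (H t)).z) ∧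
      (Measurable fun t => (cohLabel k b α a d (H t)).x) ∧
      Measurable fun t => (cohLabel k b α a d (H t)).y := by
  have hX : Measurable fun t => Complex.log ((-1) ^ vecT (sphIdx a) * expX k a d (H t)) :=
    Complex.measurable_log.comp ((measurable_expX k a d hH).const_mul _)
  have hY : Measurable fun t => Complex.log (expY k b α a d (H t)) :=
    Complex.measurable_log.comp (measurable_expY k b α a d hH)
  have hμ := measurable_muOf k b
  have hm := measurable_mOf k b
  refine ⟨?_, ?_, ?_⟩
  · exact measurable_const.mul ((Complex.measurable_ofReal.comp (hμ.comp hX)).add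
      ((Complex.measurable_ofReal.comp (hμ.comp hY)).mul_const _))
  · exact measurable_toIcoMod.comp ((hm.comp hX).const_mul _)
  · exact measurable_toIcoMod.comp ((hm.comp hY).const_mul _)

end Measurability

/-! ### The amplitude -/

/-- The moduli space is a quotient on which no Borel structure is set up, so the edge amplitude is
pulled back to pairs of holonomies. There it is continuous on a compact set, hence bounded, and its
extension by zero is Borel. -/
theorem exists_bound_and_measurable_comp {T : Type*} [MeasurableSpace T] {k : ℕ}
    {d d' : Fin 4 → ℕ} {A : HolClass → HolClass → ℂ}
    (hA : ContinuousOn (fun x : HolClass × HolClass => A x.1 x.2)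
      (su2Moduli k d ×ˢ su2Moduli k d'))
    {H H' : T → Hol} (hH : ∀ i r s, Measurable fun t => H t i r s)
    (hH' : ∀ i r s, Measurable fun t => H' t i r s) :
    ∃ (g : T → ℂ) (C : ℝ), Measurable g ∧ ∀ t, H t ∈ su2Conn k d → H' t ∈ su2Conn k d' →
      A (holMk (H t)) (holMk (H' t)) = g t ∧ ‖g t‖ ≤ C := by
  classical
  have hmk : Continuous holMk := continuous_quotient_mk'
  have hc : ContinuousOn (fun x : Hol × Hol => A (holMk x.1) (holMk x.2))
      (su2Conn k d ×ˢ su2Conn k d') :=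
    hA.comp ((hmk.comp continuous_fst).prodMk (hmk.comp continuous_snd)).continuousOn
      fun x hx => ⟨⟨_, hx.1, rfl⟩, ⟨_, hx.2, rfl⟩⟩
  have hK := (isCompact_su2Conn k d).prod (isCompact_su2Conn k d')
  obtain ⟨C, hC⟩ := hK.exists_bound_of_continuousOn hc
  -- Matrices carry the product σ-algebra, which is Borel by second countability, so entrywise
  -- measurability suffices.
  let _ : MeasurableSpace (Matrix (Fin 2) (Fin 2) ℂ) :=
    (MeasurableSpace.pi : MeasurableSpace (Fin 2 → Fin 2 → ℂ))
  have : BorelSpace (Matrix (Fin 2) (Fin 2) ℂ) := inferInstanceAs (BorelSpace (Fin 2 → Fin 2 → ℂ))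
  have : SecondCountableTopology (Matrix (Fin 2) (Fin 2) ℂ) :=
    inferInstanceAs (SecondCountableTopology (Fin 2 → Fin 2 → ℂ))
  have hm : Measurable ((su2Conn k d ×ˢ su2Conn k d').piecewise
      (fun x : Hol × Hol => A (holMk x.1) (holMk x.2)) 0) :=
    hc.measurable_piecewise continuousOn_const hK.isClosed.measurableSet
  have hpi : ∀ {F : T → Hol}, (∀ i r s, Measurable fun t => F t i r s) → Measurable F := fun hF =>
    measurable_pi_lambda _ fun i => measurable_pi_lambda (X := fun _ : Fin 2 => Fin 2 → ℂ) _
      fun r => measurable_pi_lambda _ (hF i r)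
  refine ⟨_, C, hm.comp ((hpi hH).prodMk (hpi hH')), fun t h h' => ?_⟩
  have hmem : (H t, H' t) ∈ su2Conn k d ×ˢ su2Conn k d' := ⟨h, h'⟩
  rw [Function.comp_apply, Set.piecewise_eq_of_mem _ _ _ hmem]
  exact ⟨rfl, hC _ hmem⟩

theorem cohLabel_mem_Ico (k : ℕ) (b : ℂ) (α : Fin 15 → ℝ) (a : Fin 5) (d : Fin 4 → ℕ) (H : Hol) :
    (cohLabel k b α a d H).x ∈ Set.Ico 0 (2 * Real.pi) ∧
      (cohLabel k b α a d H).y ∈ Set.Ico 0 (2 * Real.pi) := by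
  have h := fun x : ℝ => toIcoMod_mem_Ico Real.two_pi_pos 0 x
  simp only [zero_add] at h
  exact ⟨h _, h _⟩

theorem spin_lt {V : Type*} {K : PreAbstractSimplicialComplex V} {k : ℕ} {jb : Finset V → ℕ} (hjb : ∀ f, jb f < k) {c : IntFace K → ℕ}
    (hc : ∀ f, c f < k) (f : Finset V) : spin jb c f < k := by
  unfold spin
  split_ifs
  · exact hc _
  · exact hjb f

section Complex4

variable {V : Type*} [DecidableEq V] {K : PreAbstractSimplicialComplex V}

theorem Gluing.measurable_hol (G : Gluing K) (k : ℕ) (j : Finset V → ℕ)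
    (bd : Cell K × Fin 5 → Hol) (h : Cell K × Fin 5) (i : Fin 4) (r s : Fin 2) :
    Measurable fun p => G.hol k j bd p h i r s := by
  unfold Gluing.hol
  split_ifs with he hf
  · exact measurable_polygon k _ (measurable_fst.comp (measurable_pi_apply _)) i r s
  · exact measurable_polygon k _ (measurable_snd.comp (measurable_pi_apply _)) i r s
  · exact measurable_const

theorem Gluing.measurable_cohLabel [Fintype V] (G : Gluing K) (k : ℕ) (b : ℂ) (α : Fin 15 → ℝ)
    (j : Finset V → ℕ) (bd : Cell K × Fin 5 → Hol) (h : Cell K × Fin 5) :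
    (Measurable fun p => (G.cohLabel k b α j bd p h).z) ∧
      (Measurable fun p => (G.cohLabel k b α j bd p h).x) ∧
      Measurable fun p => (G.cohLabel k b α j bd p h).y := by
  have hm := Spinfoam.measurable_cohLabel k b α h.2 (G.tetSpin j h) (G.measurable_hol k j bd h)
  unfold Gluing.cohLabel
  split_ifs
  · exact ⟨measurable_conj hm.1, hm.2.1, hm.2.2.neg⟩
  · exact hm

theorem Gluing.abs_cohLabel_le [Fintype V] (G : Gluing K) (k : ℕ) (b : ℂ) (α : Fin 15 → ℝ)
    (j : Finset V → ℕ) (bd : Cell K × Fin 5 → Hol) (p : GonCoord K) (h : Cell K × Fin 5) :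
    |(G.cohLabel k b α j bd p h).x| ≤ 2 * Real.pi ∧
      |(G.cohLabel k b α j bd p h).y| ≤ 2 * Real.pi := by
  obtain ⟨hx, hy⟩ := cohLabel_mem_Ico k b α h.2 (G.tetSpin j h) (G.hol k j bd p h)
  have key : ∀ {t : ℝ}, t ∈ Set.Ico 0 (2 * Real.pi) → |t| ≤ 2 * Real.pi := fun ht => by
    rw [abs_of_nonneg ht.1]; exact ht.2.le
  unfold Gluing.cohLabel
  split_ifs
  · exact ⟨key hx, by simpa [CohLabel.J] using key hy⟩
  · exact ⟨key hx, key hy⟩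

theorem Gluing.isCompact_domain (G : Gluing K) (k : ℕ) (j : Finset V → ℕ) :
    IsCompact (G.domain k j) :=
  isCompact_univ_pi fun _ => (isCompact_Icc.prod isCompact_Icc).prod (isCompact_Icc.prod isCompact_Icc)

/-- The integrand is bounded on a compact domain: each edge factor by compactness of the moduli
spaces, each vertex factor by the uniform estimate with `|x|, |y| ≤ 2π`. -/
theorem Gluing.integrableOn_integrand [Fintype V] (G : Gluing K) (k : ℕ) [NeZero k] {b : ℂ} (hb : ‖b‖ = 1)
    (hr : 0 < b.re) (hi : b.im ≠ 0) {α β : Fin 15 → ℝ} (hαβ : PosAngle b α β) {Ae : EdgeAmp K}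
    (bd : Cell K × Fin 5 → Hol) {j : Finset V → ℕ} (hj : ∀ f, j f < k)
    (hAe : ∀ e, ContinuousOn (fun x : HolClass × HolClass => Ae e (G.tetSpin j (G.fst e)) x.1 x.2)
      (su2Moduli k (G.tetSpin j (G.fst e)) ×ˢ su2Moduli k (G.tetSpin j (G.snd e)))) :
    IntegrableOn (G.integrand k b α β Ae bd j) (G.domain k j) := by
  choose g C hg hC using fun e => exists_bound_and_measurable_comp (hAe e)
    (measurable_polygon k (G.tetSpin j (G.fst e))
      (measurable_fst.comp (measurable_pi_apply (X := fun _ : IntTet K => (ℝ × ℝ) × ℝ × ℝ) e)))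
    (measurable_polygon k (G.tetSpin j (G.snd e))
      (measurable_snd.comp (measurable_pi_apply (X := fun _ : IntTet K => (ℝ × ℝ) × ℝ × ℝ) e)))
  obtain ⟨D, hD⟩ := exists_norm_vertexAmp_le k hb hr hi hαβ (2 * Real.pi)
  have hmem : ∀ p ∈ G.domain k j, ∀ e,
      polygon k (G.tetSpin j (G.fst e)) (p e).1 ∈ su2Conn k (G.tetSpin j (G.fst e)) ∧
      polygon k (G.tetSpin j (G.snd e)) (p e).2 ∈ su2Conn k (G.tetSpin j (G.snd e)) :=
    fun p hp e => ⟨polygon_mem_su2Conn (fun i => hj _) (hp e trivial).1,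
      polygon_mem_su2Conn (fun i => hj _) (hp e trivial).2⟩
  have hdom := (G.isCompact_domain k j).isClosed.measurableSet
  -- `F` replaces the edge amplitudes by globally measurable functions that agree with them on the
  -- domain.
  let F : GonCoord K → ℂ := fun p => (∏ e, g e p) * ∏ σ : Cell K,
    vertexAmp k b α β (fun a a' => j (G.tri σ a a')) fun a => G.cohLabel k b α j bd p (σ, a)
  have hF : Measurable F := by
    refine (Finset.measurable_prod _ fun e _ => hg e).mul
      (Finset.measurable_prod _ fun σ _ => StronglyMeasurable.measurable ?_)
    exact stronglyMeasurable_vertexAmp k hb hr hi α β _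
      (fun a => (G.measurable_cohLabel k b α j bd (σ, a)).1)
      (fun a => (G.measurable_cohLabel k b α j bd (σ, a)).2.1)
      (fun a => (G.measurable_cohLabel k b α j bd (σ, a)).2.2)
  have hEq : Set.EqOn F (G.integrand k b α β Ae bd j) (G.domain k j) := fun p hp => by
    simp only [F, Gluing.integrand]
    congr 1
    exact Finset.prod_congr rfl fun e _ => (hC e p (hmem p hp e).1 (hmem p hp e).2).1.symm
  refine IntegrableOn.congr_fun ?_ hEq hdom
  refine Measure.integrableOn_of_bounded (M := (∏ e, C e) * ∏ _σ : Cell K, D)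
    (G.isCompact_domain k j).measure_lt_top.ne hF.aestronglyMeasurable ?_
  filter_upwards [ae_restrict_mem hdom] with p hp
  rw [norm_mul, norm_prod, norm_prod]
  have h1 : ∏ e, ‖g e p‖ ≤ ∏ e, C e :=
    Finset.prod_le_prod (fun _ _ => norm_nonneg _) fun e _ =>
      (hC e p (hmem p hp e).1 (hmem p hp e).2).2
  refine mul_le_mul h1 (Finset.prod_le_prod (fun _ _ => norm_nonneg _) fun σ _ => ?_)
    (Finset.prod_nonneg fun _ _ => norm_nonneg _)
    ((Finset.prod_nonneg fun _ _ => norm_nonneg _).trans h1)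
  exact hD _ _ (fun a => (G.abs_cohLabel_le k b α j bd p (σ, a)).1)
    (fun a => (G.abs_cohLabel_le k b α j bd p (σ, a)).2)

theorem Gluing.finite_admissible [Fintype V] (G : Gluing K) (k : ℕ) (jb : Finset V → ℕ) :
    (G.admissible k jb).Finite := by
  have : Finite (IntFace K) := by unfold IntFace; infer_instance
  refine (Set.Finite.pi' fun _ : IntFace K => Set.finite_Iio k).subset fun c hc => ?_
  exact fun f => hc.1 f

end Complex4

end Spinfoam

/-! ### Finiteness of the spinfoam amplitude -/

theorem mainTheorem2 {V : Type*} [Fintype V] [DecidableEq V]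
    (K : PreAbstractSimplicialComplex V) (hK : Spinfoam.IsComplex4 K) (G : Spinfoam.Gluing K)
    (k : ℕ) [NeZero k] (b : ℂ) (hb : ‖b‖ = 1) (hre : 0 < b.re) (him : b.im ≠ 0)
    (α β : Fin 15 → ℝ) (hαβ : Spinfoam.PosAngle b α β)
    (jb : Finset V → ℕ) (hjb : ∀ f, jb f < k)
    (bd : Spinfoam.Cell K × Fin 5 → Spinfoam.Hol)
    (hbd : ∀ h, ¬ Spinfoam.IsInternalTet K (Spinfoam.tet G.label h) →
      bd h ∈ Spinfoam.su2Conn k (G.tetSpin jb h))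
    (Af : Spinfoam.Face K → ℕ → ℂ) (Ae : Spinfoam.EdgeAmp K)
    (hAe : ∀ c ∈ G.admissible k jb, ∀ e,
      ContinuousOn
        (fun x : Spinfoam.HolClass × Spinfoam.HolClass =>
          Ae e (G.tetSpin (Spinfoam.spin jb c) (G.fst e)) x.1 x.2)
        (Spinfoam.su2Moduli k (G.tetSpin (Spinfoam.spin jb c) (G.fst e)) ×ˢ
          Spinfoam.su2Moduli k (G.tetSpin (Spinfoam.spin jb c) (G.snd e)))) :
    -- the state integral defining the partition function converges absolutely
    (∀ (μ : Fin 15 → ℝ) (m n : Fin 15 → ZMod k),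
      MeasureTheory.Integrable
        (Spinfoam.stInt k b β
          (Spinfoam.shiftArg b fun I => (μ I : ℂ) + α I * Complex.I) m n)) ∧
    -- the integral defining the vertex amplitude converges absolutely
    (∀ (d : Fin 5 → Fin 5 → ℕ) (ρ : Fin 5 → Spinfoam.CohLabel) (m : Fin 5 → ZMod k),
      MeasureTheory.Integrable (Spinfoam.vertexInt k b α β d ρ m)) ∧
    -- the sum over spins is finite
    (G.admissible k jb).Finite ∧
    -- for all spins, the integral over the moduli spaces is absolutely convergent over a
    -- compact domain
    (∀ c ∈ G.admissible k jb,
      IsCompact (G.domain k (Spinfoam.spin jb c)) ∧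
      MeasureTheory.IntegrableOn (G.integrand k b α β Ae bd (Spinfoam.spin jb c))
        (G.domain k (Spinfoam.spin jb c))) ∧
    -- the amplitude is finite
    G.absAmplitude k b α β Af Ae jb bd < ⊤ ∧
    HasSum (fun c : G.admissible k jb => G.term k b α β Af Ae bd (Spinfoam.spin jb c.1))
      (G.amplitude k b α β Af Ae jb bd) := by
  have hj : ∀ c ∈ G.admissible k jb, ∀ f, Spinfoam.spin jb c f < k := fun c hc =>
    Spinfoam.spin_lt hjb hc.1
  have hint : ∀ c ∈ G.admissible k jb, MeasureTheory.IntegrableOn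
      (G.integrand k b α β Ae bd (Spinfoam.spin jb c)) (G.domain k (Spinfoam.spin jb c)) :=
    fun c hc => G.integrableOn_integrand k hb hre him hαβ bd (hj c hc) (hAe c hc)
  have hfin := G.finite_admissible k jb
  have : Finite (G.admissible k jb) := hfin
  refine ⟨fun μ m n => Spinfoam.integrable_stInt k hb hre him hαβ μ m n,
    fun d ρ m => Spinfoam.integrable_vertexInt k hb hre him hαβ d ρ m, hfin,
    fun c hc => ⟨G.isCompact_domain k _, hint c hc⟩, ?_, ?_⟩
  · have : Fintype (G.admissible k jb) := Fintype.ofFinite _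
    rw [Spinfoam.Gluing.absAmplitude, tsum_fintype, ENNReal.sum_lt_top]
    intro c _
    refine ENNReal.mul_lt_top (ENNReal.prod_lt_top fun f _ => enorm_lt_top) ?_
    exact (hint c.1 c.2).2
  · exact Summable.of_finite.hasSum
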